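/- For $f\in L^2(\mathbb R)$ and the Gaussian window $\phi(x)=2^{1/4}e^{-\pi x^2}$ let $V_\phi f(\omega,t)=\int_{\mathbb R} f(x)\overline{\phi(x-t)}e^{-2\pi i\omega x}\,dx$. For a measurable set $\mathcal E\subseteq\mathbb R^2$ of finite measure, Daubechies' localization operator $P_{\mathcal E}$ is the bounded operator on $L^2(\mathbb R)$ determined by $\langle P_{\mathcal E}f,g\rangle=\langle \chi_{\mathcal E}\,V_\phi f,V_\phi g\rangle_{L^2(\mathbb R^2)}$ for all $f,g\in L^2(\mathbb R)$. Given positive integers (bases) $M_1,M_2,\dots$ and non-empty sets (alphabets) $\mathcal A_j\subseteq\{0,1,\dots,M_j-1\}$, let, for $n=0,1,2,\dots$ and $L>0$, $$C_n^{(d)}=\Big\{\sum_{j=1}^n a_j\prod_{l=1}^{j-1}M_l \;:\; a_j\in\mathcal A_j\text{ for } j=1,\dots,n\Big\},\qquad C_n(L)=\bigcup_{m\in C_n^{(d)}}\Big[\frac{mL}{M_1\cdots M_n},\frac{(m+1)L}{M_1\cdots M_n}\Big]$$ (empty sums are $0$, empty products are $1$), and for $R>0$ let $\mathcal C_n(R,\{M_j\}_j,\{\mathcal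 A_j\}_j)=\{(\omega,t)\in\mathbb R^2:\omega^2+t^2\in C_n(R^2)\}$ be the $n$-iterate spherically symmetric indexed Cantor set in the disk of radius $R$. **Theorem.** Let $\epsilon<1$, $\delta>0$ and $\gamma>0$ be real numbers. There exist finite constants $\alpha,\beta>0$, depending only on $\epsilon$, $\delta$ and $\gamma$, with the following property. Let $M>1$ be a real number, and let $M_j$, $\mathcal A_j$ $(j\ge 1)$ be bases and alphabets as above such that, for all $j\ge1$, $$M_j\in[M,M^{1+\delta}]\qquad\text{and}\qquad \frac{|\mathcal A_j|}{M_j}\le\epsilon .$$ Let the radii $R(n)>0$, $n=0,1,2,\dots$, satisfy $\pi R(n)^2\le\gamma\,(M_1M_2\cdots M_n)^{1/2}$ for all $n$. Then $$\big\|P_{\mathcal C_n(R(n),\{M_j\}_j,\{\mathcal A_j\}_j)}\big\|_{\mathrm{op}}\le\alpha e^{-\beta n}\qquad\text{for } n=0,1,2,\dots,$$ where $\|\cdot\|_{\mathrm{op}}$ is the operator norm on $L^2(\mathbb R)$. -/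

import Mathlib

open MeasureTheory

namespace CantorLocalization

/-- The Hilbert space `L²(ℝ)` of complex-valued signals. -/
abbrev SignalSpace : Type := Lp ℂ 2 (volume : Measure ℝ)

/-- The short-time Fourier transform of `f` with window `φ`, at the point `z = (ω, t)`. -/
noncomputable def stft (φ f : ℝ → ℂ) (z : ℝ × ℝ) : ℂ :=
  ∫ x : ℝ, f x * starRingEnd ℂ (φ (x - z.2)) *
    Complex.exp (-2 * Real.pi * Complex.I * z.1 * x)

/-- The normalized Gaussian window `φ(x) = 2^{1/4} e^{-π x²}`. -/
noncomputable def gaussianWindow (x : ℝ) : ℂ :=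
  (((2 : ℝ) ^ (1 / 4 : ℝ) * Real.exp (-Real.pi * x ^ 2) : ℝ) : ℂ)

/-! Basic facts on the Gaussian STFT, needed for the operator below to exist. -/

theorem continuous_gaussianWindow : Continuous gaussianWindow := by
  unfold gaussianWindow
  fun_prop

theorem norm_gaussianWindow_sq (x : ℝ) :
    ‖gaussianWindow x‖ ^ 2 = (2 : ℝ) ^ (1 / 2 : ℝ) * Real.exp (-(2 * Real.pi) * x ^ 2) := by
  have h : (0 : ℝ) ≤ (2 : ℝ) ^ (1 / 4 : ℝ) * Real.exp (-Real.pi * x ^ 2) := by positivity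
  rw [gaussianWindow, Complex.norm_real, Real.norm_of_nonneg h, mul_pow, ← Real.exp_nat_mul,
    ← Real.rpow_natCast, ← Real.rpow_mul (by norm_num)]
  norm_num
  ring

theorem integrable_norm_gaussianWindow_sq :
    Integrable (fun x : ℝ => ‖gaussianWindow x‖ ^ 2) := by
  simp_rw [norm_gaussianWindow_sq]
  exact (integrable_exp_neg_mul_sq (by positivity)).const_mul _

theorem integral_norm_gaussianWindow_sq : ∫ x : ℝ, ‖gaussianWindow x‖ ^ 2 = 1 := by
  simp_rw [norm_gaussianWindow_sq]
  rw [integral_const_mul, integral_gaussian, ← Real.sqrt_eq_rpow,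
    ← Real.sqrt_mul (by norm_num)]
  rw [show (2 : ℝ) * (Real.pi / (2 * Real.pi)) = 1 by
    field_simp, Real.sqrt_one]

/-- The integrand of the STFT, as a function of `x`. -/
noncomputable def stftIntegrand (f : ℝ → ℂ) (z : ℝ × ℝ) (x : ℝ) : ℂ :=
  f x * starRingEnd ℂ (gaussianWindow (x - z.2)) *
    Complex.exp (-2 * Real.pi * Complex.I * z.1 * x)

theorem norm_stftIntegrand (f : ℝ → ℂ) (z : ℝ × ℝ) (x : ℝ) :
    ‖stftIntegrand f z x‖ = ‖f x‖ * ‖gaussianWindow (x - z.2)‖ := by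
  have h : ‖Complex.exp (-2 * Real.pi * Complex.I * z.1 * x)‖ = 1 := by
    rw [show (-2 * Real.pi * Complex.I * z.1 * x : ℂ)
      = ((-2 * Real.pi * z.1 * x : ℝ) : ℂ) * Complex.I by push_cast; ring]
    exact Complex.norm_exp_ofReal_mul_I _
  rw [stftIntegrand, norm_mul, norm_mul, h, mul_one, RCLike.norm_conj]

theorem integrable_norm_sq (f : SignalSpace) : Integrable (fun x : ℝ => ‖f x‖ ^ 2) :=
  (memLp_two_iff_integrable_sq_norm (Lp.aestronglyMeasurable f)).1 (Lp.memLp f)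

theorem memLp_gaussianWindow_shift (t : ℝ) :
    MemLp (fun x : ℝ => gaussianWindow (x - t)) 2 volume := by
  have hc : Continuous fun x : ℝ => gaussianWindow (x - t) :=
    continuous_gaussianWindow.comp (continuous_id.sub continuous_const)
  rw [memLp_two_iff_integrable_sq_norm hc.aestronglyMeasurable]
  exact integrable_norm_gaussianWindow_sq.comp_sub_right t

theorem integrable_stftIntegrand (f : SignalSpace) (z : ℝ × ℝ) : Integrable (stftIntegrand f z) := by
  have hw := memLp_gaussianWindow_shift z.2
  have h : Integrable (fun x : ℝ => ‖f x‖ * ‖gaussianWindow (x - z.2)‖) :=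
    (Lp.memLp f).norm.integrable_mul hw.norm
  refine h.mono' ?_ (Filter.Eventually.of_forall fun x => (norm_stftIntegrand f z x).le)
  refine ((Lp.aestronglyMeasurable f).mul ?_).mul ?_
  · exact (Complex.continuous_conj.comp_aestronglyMeasurable hw.aestronglyMeasurable)
  · exact Continuous.aestronglyMeasurable (by fun_prop)

theorem norm_stft_le (f : SignalSpace) (z : ℝ × ℝ) : ‖stft gaussianWindow f z‖ ≤ ‖f‖ := by
  have hw := memLp_gaussianWindow_shift z.2
  have hf : ∫ x : ℝ, ‖f x‖ ^ (2 : ℝ) = ‖f‖ ^ 2 := by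
    have h := MeasureTheory.L2.inner_def (𝕜 := ℂ) f f
    rw [inner_self_eq_norm_sq_to_K] at h
    have h2 : (∫ x : ℝ, inner ℂ (f x) (f x)) = ((∫ x : ℝ, ‖f x‖ ^ (2 : ℝ) : ℝ) : ℂ) := by
      rw [← integral_complex_ofReal]
      congr 1
      ext x
      rw [inner_self_eq_norm_sq_to_K]
      norm_cast
    rw [h2] at h
    apply Complex.ofReal_injective
    rw [← h]
    push_cast
    rfl
  have hg : ∫ x : ℝ, ‖gaussianWindow (x - z.2)‖ ^ (2 : ℝ) = 1 := by
    have h := integral_sub_right_eq_self (μ := (volume : Measure ℝ))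
      (fun x => ‖gaussianWindow x‖ ^ (2 : ℝ)) z.2
    rw [h]
    simp_rw [Real.rpow_two]
    exact integral_norm_gaussianWindow_sq
  calc ‖stft gaussianWindow f z‖ ≤ ∫ x : ℝ, ‖stftIntegrand f z x‖ :=
        norm_integral_le_integral_norm _
    _ = ∫ x : ℝ, ‖f x‖ * ‖gaussianWindow (x - z.2)‖ := by simp_rw [norm_stftIntegrand]
    _ ≤ (∫ x : ℝ, ‖f x‖ ^ (2 : ℝ)) ^ (1 / (2 : ℝ)) *
          (∫ x : ℝ, ‖gaussianWindow (x - z.2)‖ ^ (2 : ℝ)) ^ (1 / (2 : ℝ)) := by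
        refine integral_mul_norm_le_Lp_mul_Lq (by constructor <;> norm_num) ?_ ?_
        · simpa using Lp.memLp f
        · simpa using hw
    _ = ‖f‖ := by
        rw [hf, hg, Real.one_rpow, mul_one, ← Real.sqrt_eq_rpow, Real.sqrt_sq (norm_nonneg _)]

theorem stronglyMeasurable_stft (f : SignalSpace) : StronglyMeasurable (stft gaussianWindow f) := by
  refine StronglyMeasurable.integral_prod_right
    (f := fun z : ℝ × ℝ => fun x : ℝ => stftIntegrand f z x) ?_
  refine StronglyMeasurable.mul (StronglyMeasurable.mul ?_ ?_) ?_
  · exact (Lp.stronglyMeasurable f).comp_measurable measurable_snd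
  · refine Continuous.stronglyMeasurable ?_
    exact Complex.continuous_conj.comp (continuous_gaussianWindow.comp (by fun_prop))
  · exact Continuous.stronglyMeasurable (by fun_prop)

theorem stft_add (f g : SignalSpace) (z : ℝ × ℝ) : stft gaussianWindow (f + g : SignalSpace) z =
    stft gaussianWindow f z + stft gaussianWindow g z := by
  have h := integral_add (integrable_stftIntegrand f z) (integrable_stftIntegrand g z)
  unfold stft
  unfold stftIntegrand at h
  rw [← h]
  refine integral_congr_ae ?_
  filter_upwards [Lp.coeFn_add f g] with x hx
  rw [hx, Pi.add_apply]
  ring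

theorem stft_smul (c : ℂ) (f : SignalSpace) (z : ℝ × ℝ) : stft gaussianWindow (c • f : SignalSpace) z =
    c * stft gaussianWindow f z := by
  unfold stft
  rw [← integral_const_mul]
  refine integral_congr_ae ?_
  filter_upwards [Lp.coeFn_smul c f] with x hx
  rw [hx, Pi.smul_apply, smul_eq_mul]
  ring

theorem norm_formIntegrand_le (F : ℝ × ℝ → ℝ) (f g : SignalSpace) (z : ℝ × ℝ) :
    ‖(F z : ℂ) * (starRingEnd ℂ (stft gaussianWindow f z) * stft gaussianWindow g z)‖
      ≤ ‖F z‖ * (‖f‖ * ‖g‖) := by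
  rw [norm_mul, norm_mul, RCLike.norm_conj, Complex.norm_real]
  gcongr
  · exact norm_stft_le f z
  · exact norm_stft_le g z

theorem integrable_formIntegrand {F : ℝ × ℝ → ℝ} (hF : Integrable F) (f g : SignalSpace) :
    Integrable fun z : ℝ × ℝ =>
      (F z : ℂ) * (starRingEnd ℂ (stft gaussianWindow f z) * stft gaussianWindow g z) := by
  refine (hF.norm.mul_const (‖f‖ * ‖g‖)).mono' ?_
    (Filter.Eventually.of_forall (norm_formIntegrand_le F f g))
  refine hF.ofReal.aestronglyMeasurable.mul (StronglyMeasurable.aestronglyMeasurable ?_)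
  exact (Complex.continuous_conj.comp_stronglyMeasurable (stronglyMeasurable_stft f)).mul
    (stronglyMeasurable_stft g)

/-- The bounded sesquilinear form `(f, g) ↦ ∫ F · conj (V f) · V g` on `L²(ℝ)`
(conjugate-linear in the first argument, as is Mathlib's inner product). -/
noncomputable def localizationForm (F : ℝ × ℝ → ℝ) (hF : Integrable F) : SignalSpace →L⋆[ℂ] SignalSpace →L[ℂ] ℂ :=
  LinearMap.mkContinuous₂
    (LinearMap.mk₂'ₛₗ (starRingEnd ℂ) (RingHom.id ℂ)
      (fun f g : SignalSpace => ∫ z : ℝ × ℝ,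
        (F z : ℂ) * (starRingEnd ℂ (stft gaussianWindow f z) * stft gaussianWindow g z))
      (fun f₁ f₂ g => by
        rw [← integral_add (integrable_formIntegrand hF f₁ g) (integrable_formIntegrand hF f₂ g)]
        refine integral_congr_ae (Filter.Eventually.of_forall fun z => ?_)
        simp only [stft_add, map_add]
        ring)
      (fun c f g => by
        rw [smul_eq_mul, ← integral_const_mul]
        refine integral_congr_ae (Filter.Eventually.of_forall fun z => ?_)
        simp only [stft_smul, map_mul]
        ring)
      (fun f g₁ g₂ => by
        rw [← integral_add (integrable_formIntegrand hF f g₁) (integrable_formIntegrand hF f g₂)]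
        refine integral_congr_ae (Filter.Eventually.of_forall fun z => ?_)
        simp only [stft_add]
        ring)
      (fun c f g => by
        rw [RingHom.id_apply, smul_eq_mul, ← integral_const_mul]
        refine integral_congr_ae (Filter.Eventually.of_forall fun z => ?_)
        simp only [stft_smul]
        ring))
    (∫ z, ‖F z‖)
    (fun f g => by
      rw [mul_assoc, ← integral_mul_const]
      exact norm_integral_le_of_norm_le (hF.norm.mul_const _)
        (Filter.Eventually.of_forall (norm_formIntegrand_le F f g)))

/-- Daubechies' localization operator on `L²(ℝ)` with Gaussian window and integrable real
weight `F`: the bounded operator `P` with `⟨P f, g⟩ = ⟨F · V f, V g⟩` for all `f`, `g`. -/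
noncomputable def localizationOperator (F : ℝ × ℝ → ℝ) (hF : Integrable F) : SignalSpace →L[ℂ] SignalSpace :=
  InnerProductSpace.continuousLinearMapOfBilin (localizationForm F hF)

/-- The weak identity that characterizes the operator (with the inner product of `L²(ℝ)`
written linearly in the left signal `f`, that is, as Mathlib's `inner ℂ g (P f)`). -/
theorem inner_localizationOperator (F : ℝ × ℝ → ℝ) (hF : Integrable F) (f g : SignalSpace) :
    inner ℂ g (localizationOperator F hF f) = ∫ z : ℝ × ℝ,
      ((F z : ℂ) * stft gaussianWindow f z) * starRingEnd ℂ (stft gaussianWindow g z) := by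
  have h : inner ℂ (localizationOperator F hF f) g = ∫ z : ℝ × ℝ,
      (F z : ℂ) * (starRingEnd ℂ (stft gaussianWindow f z) * stft gaussianWindow g z) :=
    InnerProductSpace.continuousLinearMapOfBilin_apply (localizationForm F hF) f g
  rw [← inner_conj_symm, h, ← integral_conj]
  refine integral_congr_ae (Filter.Eventually.of_forall fun z => ?_)
  simp only [map_mul, Complex.conj_conj, Complex.conj_ofReal]
  ring

/-! Indexed Cantor sets. Sequences are indexed from `0`: `b j` and `A j` are the base and the
alphabet number `j + 1`. -/

/-- The `n`-iterate discrete indexed Cantor set: all sums `∑_{j < n} a_j ∏_{l < j} b_l` with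
digits `a_j ∈ A_j`. -/
def discreteCantorSet (b : ℕ → ℕ) (A : ℕ → Finset ℕ) (n : ℕ) : Set ℕ :=
  {m | ∃ a : ℕ → ℕ, (∀ j < n, a j ∈ A j) ∧
    m = ∑ j ∈ Finset.range n, a j * ∏ l ∈ Finset.range j, b l}

/-- The length `L (b_0 ⋯ b_{n-1})⁻¹` of the intervals of the `n`-iterate based in `[0, L]`. -/
noncomputable def blockLength (L : ℝ) (b : ℕ → ℕ) (n : ℕ) : ℝ :=
  L * (∏ l ∈ Finset.range n, (b l : ℝ))⁻¹

/-- The `n`-iterate indexed Cantor set based in `[0, L]`. -/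
def cantorSet (L : ℝ) (b : ℕ → ℕ) (A : ℕ → Finset ℕ) (n : ℕ) : Set ℝ :=
  ⋃ m ∈ discreteCantorSet b A n,
    Set.Icc (blockLength L b n * (m : ℝ)) (blockLength L b n * (m : ℝ) + blockLength L b n)

/-- The `n`-iterate spherically symmetric indexed Cantor set in the disk of radius `R`. -/
def sphericalCantorSet (R : ℝ) (b : ℕ → ℕ) (A : ℕ → Finset ℕ) (n : ℕ) : Set (ℝ × ℝ) :=
  {z | z.1 ^ 2 + z.2 ^ 2 ∈ cantorSet (R ^ 2) b A n}

theorem finite_discreteCantorSet (b : ℕ → ℕ) (A : ℕ → Finset ℕ) (n : ℕ) :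
    (discreteCantorSet b A n).Finite := by
  refine Set.Finite.subset (Set.finite_Iic
    (∑ j ∈ Finset.range n, (A j).sup id * ∏ l ∈ Finset.range j, b l)) ?_
  rintro m ⟨a, ha, rfl⟩
  refine Finset.sum_le_sum fun j hj => Nat.mul_le_mul_right _ ?_
  exact Finset.le_sup (f := id) (ha j (Finset.mem_range.1 hj))

theorem measurableSet_sphericalCantorSet (R : ℝ) (b : ℕ → ℕ) (A : ℕ → Finset ℕ) (n : ℕ) :
    MeasurableSet (sphericalCantorSet R b A n) := by
  have h : MeasurableSet (cantorSet (R ^ 2) b A n) :=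
    MeasurableSet.biUnion (Set.to_countable _) fun _ _ => measurableSet_Icc
  have hm : Measurable fun z : ℝ × ℝ => z.1 ^ 2 + z.2 ^ 2 := by fun_prop
  exact hm h

theorem volume_sphericalCantorSet_lt_top (R : ℝ) (b : ℕ → ℕ) (A : ℕ → Finset ℕ) (n : ℕ) :
    volume (sphericalCantorSet R b A n) < ⊤ := by
  have hb : Bornology.IsBounded (cantorSet (R ^ 2) b A n) :=
    (Bornology.isBounded_biUnion (finite_discreteCantorSet b A n)).2
      fun _ _ => Metric.isBounded_Icc _ _
  obtain ⟨C, hC⟩ := hb.bddAbove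
  refine Bornology.IsBounded.measure_lt_top ?_
  refine (Metric.isBounded_Icc ((-(C + 1), -(C + 1)) : ℝ × ℝ) (C + 1, C + 1)).subset ?_
  intro z hz
  have h : z.1 ^ 2 + z.2 ^ 2 ≤ C := hC hz
  refine ⟨⟨?_, ?_⟩, ⟨?_, ?_⟩⟩ <;> simp only <;>
    nlinarith [sq_nonneg z.1, sq_nonneg z.2, sq_nonneg (z.1 + 1), sq_nonneg (z.1 - 1),
      sq_nonneg (z.2 + 1), sq_nonneg (z.2 - 1)]

theorem integrable_indicator_sphericalCantorSet (R : ℝ) (b : ℕ → ℕ) (A : ℕ → Finset ℕ) (n : ℕ) :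
    Integrable ((sphericalCantorSet R b A n).indicator fun _ : ℝ × ℝ => (1 : ℝ)) :=
  (integrable_indicator_iff (measurableSet_sphericalCantorSet R b A n)).2
    (integrableOn_const (volume_sphericalCantorSet_lt_top R b A n).ne)

/-- The localization operator that projects onto the `n`-iterate spherically symmetric indexed
Cantor set in the disk of radius `R`: its weight is the indicator function of that set. -/
noncomputable def cantorLocalizationOperator (R : ℝ) (b : ℕ → ℕ) (A : ℕ → Finset ℕ) (n : ℕ) :
    SignalSpace →L[ℂ] SignalSpace :=
  localizationOperator ((sphericalCantorSet R b A n).indicator fun _ => 1)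
    (integrable_indicator_sphericalCantorSet R b A n)

end CantorLocalization

open MeasureTheory

namespace CantorLocalization

open scoped FourierTransform ENNReal

/-! Up to a phase and the weight `exp (-π|ζ|²/2)`, the Gaussian STFT is an entire function `F(ζ) = ∑
c_k ζ^k` with `ζ = ω + it` (the Bargmann transform). On a circle the monomials are orthogonal, so
over a rotation-invariant set the energy of the STFT has no cross terms. After `s = π r²` each
monomial contributes a multiple of the Gamma density `s^k e^{-s} / k!`. By Moyal's identity the
multiples add up to `‖f‖²`. Hence the operator norm is at most the largest mass that one of these
densities gives to the dilated one-dimensional Cantor set (`norm_cantorLocalizationOperator_le`).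

That mass is bounded uniformly in `k`, because every Gamma density has total variation at most 2.
Cut the half-line into blocks of length `T`, each made of `Q` equal cells. On a block the density is
at most its mean plus its variation, so keeping `|D|` of the `Q` cells in every block leaves mass at
most `(|D|/Q)(1 + 2T)` (`setLIntegral_gammaWeight_biUnion_le`).

For the Cantor set, the `p` lowest digits decide which cells of a block survive; the higher digits
are ignored. So `|D|/Q ≤ ε^p` and `Q = b_0 ⋯ b_{p-1}`. With `N = b_0 ⋯ b_{n-1}` the block length is
`T = πR²Q/N`. Since `πR² ≤ γ√N`, it is at most `γ` once `Q ≤ √N`. Comparability of the bases gives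
this for `p = ⌊n / (2(1+δ))⌋`, which is linear in `n`; hence the exponential decay. -/

/-! ### Plancherel's and Moyal's identities -/

/-- On `L¹ ∩ L²` the `L²`-Fourier transform is given by the Fourier integral. -/
theorem coeFn_fourier_toLp {h : ℝ → ℂ} (h1 : Integrable h) (h2 : MemLp h 2) :
    (𝓕 (h2.toLp h) : Lp ℂ 2 (volume : Measure ℝ)) =ᵐ[volume] 𝓕 h := by
  have hcont : Continuous (𝓕 h) :=
    VectorFourier.fourierIntegral_continuous Real.continuous_fourierChar
      continuous_inner h1
  -- Both sides are tested against smooth compactly supported `g`. Such `g` are Schwartz functions,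
  -- so the `L²` transform can be moved onto `g` by duality and the integral transform by Fubini.
  refine ae_eq_of_integral_contDiff_smul_eq
    ((Lp.memLp (𝓕 (h2.toLp h))).locallyIntegrable (by norm_num)) hcont.locallyIntegrable ?_
  intro g hg hgc
  have hgc' : HasCompactSupport fun x => (g x : ℂ) := hgc.comp_left (g := Complex.ofReal) rfl
  have hg' : ContDiff ℝ ((⊤ : ℕ∞) : WithTop ℕ∞) fun x => (g x : ℂ) :=
    Complex.ofRealCLM.contDiff.comp hg
  let G : SchwartzMap ℝ ℂ := hgc'.toSchwartzMap hg'
  have hG : ∀ x, G x = (g x : ℂ) := fun x => rfl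
  have e1 : ∫ x, g x • (𝓕 (h2.toLp h) : Lp ℂ 2 (volume : Measure ℝ)) x =
      Lp.toTemperedDistribution (𝓕 (h2.toLp h)) G := by
    rw [Lp.toTemperedDistribution_apply]
    simp [hG]
  rw [e1, ← Lp.fourier_toTemperedDistribution_eq, TemperedDistribution.fourier_apply,
    Lp.toTemperedDistribution_apply]
  have e2 := VectorFourier.integral_fourierIntegral_smul_eq_flip (μ := (volume : Measure ℝ))
    (ν := (volume : Measure ℝ)) (L := innerₗ ℝ) (f := (G : ℝ → ℂ)) (g := h)
    Real.continuous_fourierChar continuous_inner G.integrable h1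
  rw [flip_innerₗ] at e2
  calc ∫ x, (𝓕 G) x • h2.toLp h x = ∫ x, (𝓕 G) x • h x := by
        refine integral_congr_ae ?_
        filter_upwards [h2.coeFn_toLp] with x hx
        rw [hx]
    _ = ∫ x, G x • 𝓕 h x := e2
    _ = ∫ x, g x • 𝓕 h x := by simp [hG]

/-- The squared norm in `L²` as a lower Lebesgue integral. -/
theorem lintegral_enorm_sq_coeFn (f : SignalSpace) :
    ∫⁻ x, ‖f x‖ₑ ^ 2 = ENNReal.ofReal (‖f‖ ^ 2) := by
  rw [Lp.norm_def, ← ENNReal.toReal_pow,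
    ENNReal.ofReal_toReal (ENNReal.pow_ne_top (Lp.memLp f).2.ne)]
  have h := eLpNorm_nnreal_pow_eq_lintegral (μ := volume) (f := f) (p := 2) (by norm_num)
  simp only [NNReal.coe_ofNat, ENNReal.rpow_ofNat, ENNReal.coe_ofNat] at h
  exact h.symm

/-- **Plancherel's identity** for the Fourier integral on `L¹ ∩ L²`. -/
theorem lintegral_enorm_fourier_sq {h : ℝ → ℂ} (h1 : Integrable h) (h2 : MemLp h 2) :
    ∫⁻ ω, ‖𝓕 h ω‖ₑ ^ 2 = ∫⁻ x, ‖h x‖ₑ ^ 2 := by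
  calc ∫⁻ ω, ‖𝓕 h ω‖ₑ ^ 2
      = ∫⁻ ω, ‖(𝓕 (h2.toLp h) : Lp ℂ 2 (volume : Measure ℝ)) ω‖ₑ ^ 2 := by
        refine lintegral_congr_ae ?_
        filter_upwards [coeFn_fourier_toLp h1 h2] with x hx
        rw [hx]
    _ = ∫⁻ x, ‖h2.toLp h x‖ₑ ^ 2 := by
        rw [lintegral_enorm_sq_coeFn, lintegral_enorm_sq_coeFn, Lp.norm_fourier_eq]
    _ = ∫⁻ x, ‖h x‖ₑ ^ 2 := by
        refine lintegral_congr_ae ?_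
        filter_upwards [h2.coeFn_toLp] with x hx
        rw [hx]

theorem norm_gaussianWindow_le (x : ℝ) : ‖gaussianWindow x‖ ≤ 2 := by
  have h : (0 : ℝ) ≤ (2 : ℝ) ^ (1 / 4 : ℝ) * Real.exp (-Real.pi * x ^ 2) := by positivity
  rw [gaussianWindow, Complex.norm_real, Real.norm_of_nonneg h]
  have h1 : (2 : ℝ) ^ (1 / 4 : ℝ) ≤ 2 ^ (1 : ℝ) :=
    Real.rpow_le_rpow_of_exponent_le (by norm_num) (by norm_num)
  have h2 : Real.exp (-Real.pi * x ^ 2) ≤ 1 := by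
    rw [Real.exp_le_one_iff]
    nlinarith [Real.pi_pos, sq_nonneg x, mul_nonneg Real.pi_pos.le (sq_nonneg x)]
  rw [Real.rpow_one] at h1
  calc _ ≤ (2 : ℝ) * 1 := by gcongr
    _ = 2 := by norm_num

theorem lintegral_enorm_gaussianWindow_sq : ∫⁻ x : ℝ, ‖gaussianWindow x‖ₑ ^ 2 = 1 := by
  have h := ofReal_integral_eq_lintegral_ofReal integrable_norm_gaussianWindow_sq
    (Filter.Eventually.of_forall fun x => by positivity)
  rw [integral_norm_gaussianWindow_sq, ENNReal.ofReal_one] at h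
  rw [h]
  refine lintegral_congr fun x => ?_
  rw [ENNReal.ofReal_pow (norm_nonneg _), ofReal_norm]

/-- **Moyal's identity**: the Gaussian STFT is an isometry into `L²(ℝ²)`. -/
theorem lintegral_enorm_stft_sq (f : SignalSpace) :
    ∫⁻ z : ℝ × ℝ, ‖stft gaussianWindow f z‖ₑ ^ 2 = ENNReal.ofReal (‖f‖ ^ 2) := by
  have hmeas : Measurable fun z : ℝ × ℝ => ‖stft gaussianWindow f z‖ₑ ^ 2 :=
    (stronglyMeasurable_stft f).enorm.pow_const 2
  have hf : Measurable fun x => ‖f x‖ₑ ^ 2 := (Lp.stronglyMeasurable f).enorm.pow_const 2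
  have hφ : Measurable fun x => ‖gaussianWindow x‖ₑ ^ 2 :=
    continuous_gaussianWindow.measurable.enorm.pow_const 2
  rw [Measure.volume_eq_prod, lintegral_prod_symm _ hmeas.aemeasurable]
  -- For fixed `t` the STFT is the Fourier transform in `ω` of `f` times the shifted window, so
  -- Plancherel applies slice by slice.
  have key (t : ℝ) : ∫⁻ ω, ‖stft gaussianWindow f (ω, t)‖ₑ ^ 2 =
      ∫⁻ x, ‖f x‖ₑ ^ 2 * ‖gaussianWindow (x - t)‖ₑ ^ 2 := by
    let h : ℝ → ℂ := fun x => f x * starRingEnd ℂ (gaussianWindow (x - t))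
    have hconj : Continuous fun x => starRingEnd ℂ (gaussianWindow (x - t)) :=
      Complex.continuous_conj.comp (continuous_gaussianWindow.comp (by fun_prop))
    have h1 : Integrable h := by
      refine (integrable_stftIntegrand f (0, t)).congr (Filter.Eventually.of_forall fun x => ?_)
      simp [stftIntegrand, h]
    have h2 : MemLp h 2 := by
      refine ((Lp.memLp f).const_mul 2).mono
        ((Lp.aestronglyMeasurable f).mul hconj.aestronglyMeasurable) ?_
      refine Filter.Eventually.of_forall fun x => ?_
      simp only [h, norm_mul, RCLike.norm_conj, RCLike.norm_ofNat]
      rw [mul_comm]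
      gcongr
      exact norm_gaussianWindow_le _
    have h3 (ω : ℝ) : stft gaussianWindow f (ω, t) = 𝓕 h ω := by
      rw [Real.fourier_eq', stft]
      refine integral_congr_ae (Filter.Eventually.of_forall fun x => ?_)
      simp only [h, smul_eq_mul, RCLike.inner_apply, conj_trivial]
      rw [mul_comm]
      congr 2
      push_cast
      ring
    simp_rw [h3]
    rw [lintegral_enorm_fourier_sq h1 h2]
    refine lintegral_congr fun x => ?_
    simp [h, mul_pow]
  simp_rw [key]
  rw [lintegral_lintegral_swap]
  · calc ∫⁻ x, ∫⁻ t, ‖f x‖ₑ ^ 2 * ‖gaussianWindow (x - t)‖ₑ ^ 2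
        = ∫⁻ x, ‖f x‖ₑ ^ 2 := by
          refine lintegral_congr fun x => ?_
          have hs : Measurable fun t => ‖gaussianWindow (x - t)‖ₑ ^ 2 :=
            hφ.comp (measurable_const.sub measurable_id)
          rw [lintegral_const_mul _ hs,
            lintegral_sub_left_eq_self (fun t => ‖gaussianWindow t‖ₑ ^ 2) x,
            lintegral_enorm_gaussianWindow_sq, mul_one]
      _ = _ := lintegral_enorm_sq_coeFn f
  · refine Measurable.aemeasurable ?_
    exact (hf.comp measurable_snd).mul (hφ.comp (measurable_snd.sub measurable_fst))

/-! ### The STFT as a weighted entire function -/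

/-- Supplies the majorant for integrating the exponential series term by term. The square of the
Gaussian factor stays integrable because `2c|x| ≤ c² + x²` costs only part of the exponent `-2πx²`.
-/
theorem integrable_norm_mul_gaussian_mul_exp (f : SignalSpace) (c : ℝ) :
    Integrable fun x : ℝ => ‖f x‖ * (Real.exp (-Real.pi * x ^ 2) * Real.exp (c * |x|)) := by
  have hc : Continuous fun x : ℝ => Real.exp (-Real.pi * x ^ 2) * Real.exp (c * |x|) := by
    fun_prop
  refine MemLp.integrable_mul (p := 2) (q := 2) (Lp.memLp f).norm ?_
  rw [memLp_two_iff_integrable_sq_norm hc.aestronglyMeasurable]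
  have hdom : Integrable fun x : ℝ => Real.exp (c ^ 2) * Real.exp (-(2 * Real.pi - 1) * x ^ 2) :=
    (integrable_exp_neg_mul_sq (by linarith [Real.pi_gt_three])).const_mul _
  refine hdom.mono' (hc.norm.pow 2).aestronglyMeasurable (Filter.Eventually.of_forall fun x => ?_)
  rw [norm_pow, norm_norm, Real.norm_of_nonneg (by positivity), ← Real.exp_add, ← Real.exp_add,
    ← Real.exp_nat_mul]
  refine Real.exp_le_exp.2 ?_
  push_cast
  nlinarith [sq_nonneg (c - |x|), sq_abs x]

/-- The integral `∫ f(x) e^{-πx²} e^{2πxz} dx` is the sum of a power series in `z`. -/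
theorem hasSum_integral_mul_exp (f : SignalSpace) (z : ℂ) :
    HasSum (fun k : ℕ => (∫ x : ℝ, f x * Real.exp (-Real.pi * x ^ 2) *
        ((2 * Real.pi * x : ℂ) ^ k / k.factorial)) * z ^ k)
      (∫ x : ℝ, f x * Real.exp (-Real.pi * x ^ 2) * Complex.exp (2 * Real.pi * x * z)) := by
  let F : ℕ → ℝ → ℂ := fun k x =>
    f x * Real.exp (-Real.pi * x ^ 2) * ((2 * Real.pi * x * z : ℂ) ^ k / k.factorial)
  have hsum (x : ℝ) : HasSum (fun k => F k x)
      (f x * Real.exp (-Real.pi * x ^ 2) * Complex.exp (2 * Real.pi * x * z)) := by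
    refine HasSum.mul_left _ ?_
    rw [Complex.exp_eq_exp_ℂ]
    exact NormedSpace.expSeries_div_hasSum_exp _
  let c : ℝ := 2 * Real.pi * ‖z‖
  have hnorm (k : ℕ) (x : ℝ) : ‖F k x‖ =
      ‖f x‖ * (Real.exp (-Real.pi * x ^ 2) * ((c * |x|) ^ k / k.factorial)) := by
    simp only [F, c, norm_mul, norm_div, norm_pow, Complex.norm_real, RCLike.norm_natCast,
      Real.norm_eq_abs, Real.abs_exp, RCLike.norm_ofNat, abs_of_pos Real.pi_pos]
    ring
  have hnormsum (x : ℝ) : HasSum (fun k => ‖F k x‖)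
      (‖f x‖ * (Real.exp (-Real.pi * x ^ 2) * Real.exp (c * |x|))) := by
    simp_rw [hnorm]
    refine (HasSum.mul_left _ ?_).mul_left _
    rw [Real.exp_eq_exp_ℝ]
    exact NormedSpace.expSeries_div_hasSum_exp _
  have hmeas (k : ℕ) : AEStronglyMeasurable (F k) volume := by
    refine ((Lp.aestronglyMeasurable f).mul ?_).mul ?_
    · exact Continuous.aestronglyMeasurable (by fun_prop)
    · exact Continuous.aestronglyMeasurable (by fun_prop)
  have h := hasSum_integral_of_dominated_convergence (μ := volume) (F := F)
    (fun k x => ‖F k x‖) hmeas (fun k => Filter.Eventually.of_forall fun x => le_rfl)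
    (Filter.Eventually.of_forall fun x => (hnormsum x).summable)
    ((integrable_norm_mul_gaussian_mul_exp f c).congr
      (Filter.Eventually.of_forall fun x => (hnormsum x).tsum_eq.symm))
    (Filter.Eventually.of_forall hsum)
  convert! h using 2 with k
  rw [← integral_mul_const]
  refine integral_congr_ae (Filter.Eventually.of_forall fun x => ?_)
  simp only [F]
  rw [mul_pow _ z]
  ring

theorem differentiable_integral_mul_exp (f : SignalSpace) : Differentiable ℂ fun z : ℂ =>
    ∫ x : ℝ, f x * Real.exp (-Real.pi * x ^ 2) * Complex.exp (2 * Real.pi * x * z) := by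
  let p : FormalMultilinearSeries ℂ ℂ ℂ := FormalMultilinearSeries.ofScalars ℂ fun k : ℕ =>
    ∫ x : ℝ, f x * Real.exp (-Real.pi * x ^ 2) * ((2 * Real.pi * x : ℂ) ^ k / k.factorial)
  have hp : HasFPowerSeriesOnBall (fun z : ℂ => ∫ x : ℝ, f x * Real.exp (-Real.pi * x ^ 2) *
      Complex.exp (2 * Real.pi * x * z)) p 0 ⊤ := by
    refine ⟨?_, ENNReal.zero_lt_top, fun {y} _ => ?_⟩
    -- The radius is infinite since the series converges absolutely at every real `r ≥ 0`.
    · refine le_of_eq (Eq.symm ?_)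
      rw [FormalMultilinearSeries.radius_eq_top_iff_summable_norm]
      intro r
      have := (hasSum_integral_mul_exp f (r : ℂ)).summable.norm
      refine this.congr fun k => ?_
      simp [p]
    · rw [zero_add]
      simpa [p, FormalMultilinearSeries.ofScalars_apply_eq, mul_comm]
        using hasSum_integral_mul_exp f y
  intro z
  exact (hp.analyticOnNhd z (by simp)).differentiableAt

/-- Up to a Gaussian weight the modulus of the Gaussian STFT is that of an entire function. -/
theorem exists_differentiable_norm_stft (f : SignalSpace) : ∃ F : ℂ → ℂ, Differentiable ℂ F ∧
    ∀ z : ℝ × ℝ, ‖stft gaussianWindow f z‖ =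
      Real.exp (-(Real.pi / 2) * (z.1 ^ 2 + z.2 ^ 2)) * ‖F (z.1 + z.2 * Complex.I)‖ := by
  -- With `ζ = ω + it`, one has `-iζ = t - iω`, so the last exponential carries both the modulation
  -- and the cross term of the shifted Gaussian. The factor `exp (πζ²/2)` turns the remaining `exp
  -- (-πt²)` into the rotation-invariant weight times a phase.
  refine ⟨fun ζ => ((2 : ℝ) ^ (1 / 4 : ℝ) : ℝ) * Complex.exp (Real.pi / 2 * ζ ^ 2) *
    ∫ x : ℝ, f x * Real.exp (-Real.pi * x ^ 2) *
      Complex.exp (2 * Real.pi * x * (-Complex.I * ζ)), ?_, ?_⟩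
  · have h := (differentiable_integral_mul_exp f).comp
      (differentiable_id.const_mul (-Complex.I))
    exact (Differentiable.mul (by fun_prop) (by fun_prop)).mul h
  · rintro ⟨ω, t⟩
    have hexp : stft gaussianWindow f (ω, t) =
        Complex.exp (-(Real.pi / 2) * (ω ^ 2 + t ^ 2) : ℝ) *
        Complex.exp ((-Real.pi * ω * t : ℝ) * Complex.I) *
        (((2 : ℝ) ^ (1 / 4 : ℝ) : ℝ) * Complex.exp (Real.pi / 2 * (ω + t * Complex.I) ^ 2) *
          ∫ x : ℝ, f x * Real.exp (-Real.pi * x ^ 2) *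
            Complex.exp (2 * Real.pi * x * (-Complex.I * (ω + t * Complex.I)))) := by
      rw [stft, ← integral_const_mul, ← integral_const_mul]
      refine integral_congr_ae (Filter.Eventually.of_forall fun x => ?_)
      simp only [gaussianWindow, Complex.conj_ofReal]
      rw [Complex.ofReal_mul ((2 : ℝ) ^ (1 / 4 : ℝ)), Complex.ofReal_exp, Complex.ofReal_exp]
      have e : Complex.exp ((-Real.pi * (x - t) ^ 2 : ℝ) : ℂ) *
          Complex.exp (-2 * Real.pi * Complex.I * ω * x) =
          Complex.exp (-(Real.pi / 2) * (ω ^ 2 + t ^ 2) : ℝ) *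
          Complex.exp ((-Real.pi * ω * t : ℝ) * Complex.I) *
          Complex.exp (Real.pi / 2 * (ω + t * Complex.I) ^ 2) *
          Complex.exp ((-Real.pi * x ^ 2 : ℝ) : ℂ) *
          Complex.exp (2 * Real.pi * x * (-Complex.I * (ω + t * Complex.I))) := by
        simp only [← Complex.exp_add]
        congr 1
        push_cast
        linear_combination (-(Real.pi : ℂ) / 2 * t ^ 2 + 2 * Real.pi * x * t) * Complex.I_sq
      linear_combination (f x * (((2 : ℝ) ^ (1 / 4 : ℝ) : ℝ) : ℂ)) * e
    rw [hexp, norm_mul, norm_mul, Complex.norm_exp_ofReal_mul_I, mul_one, Complex.norm_exp_ofReal]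

/-! ### Reduction to Gamma densities -/

/-- **Parseval's identity** on a circle for the sum of an everywhere convergent power series. -/
theorem hasSum_sq_norm_coeff_circleAverage {F : ℂ → ℂ} {c : ℕ → ℂ}
    (hF : ∀ z, HasSum (fun k => c k * z ^ k) (F z)) (r : ℝ) :
    HasSum (fun k => (‖c k‖ * |r| ^ k) ^ 2) (Real.circleAverage (fun z => ‖F z‖ ^ 2) 0 r) := by
  let a : ℕ → ℂ := fun k => c k * (r : ℂ) ^ k
  have ha (k : ℕ) : ‖a k‖ = ‖c k‖ * |r| ^ k := by simp [a]
  have hsum : Summable fun k => ‖a k‖ := (hF r).summable.norm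
  -- The radius is absorbed into the coefficients of the partial sums, so that Parseval for
  -- polynomials on the unit circle applies; the limit follows by dominated convergence with
  -- majorant `(∑ ‖a k‖)²`.
  let p : ℕ → Polynomial ℂ := fun n => ∑ k ∈ Finset.range n, Polynomial.monomial k (a k)
  have hcoeff (n i : ℕ) : (p n).coeff i = if i < n then a i else 0 := by
    simp [p, Polynomial.finsetSum_coeff, Polynomial.coeff_monomial]
  have hpsum (n : ℕ) : ∑ i ∈ (p n).support, ‖(p n).coeff i‖ ^ 2 =
      ∑ i ∈ Finset.range n, ‖a i‖ ^ 2 := by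
    rw [Finset.sum_subset (s₂ := Finset.range n)]
    · refine Finset.sum_congr rfl fun i hi => ?_
      rw [hcoeff, if_pos (Finset.mem_range.1 hi)]
    · intro i hi
      by_contra h
      rw [Polynomial.mem_support_iff, hcoeff, if_neg (by simpa using h)] at hi
      exact hi rfl
    · intro i _ hi
      rw [Polynomial.notMem_support_iff.1 hi]
      simp
  have heval (n : ℕ) (θ : ℝ) : (p n).eval (circleMap 0 1 θ) =
      ∑ k ∈ Finset.range n, c k * circleMap 0 r θ ^ k := by
    simp only [p, Polynomial.eval_finsetSum, Polynomial.eval_monomial, a, circleMap, zero_add,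
      Complex.ofReal_one, one_mul, mul_pow]
    exact Finset.sum_congr rfl fun k _ => by ring
  rw [hasSum_iff_tendsto_nat_of_nonneg (fun k => by positivity)]
  simp_rw [← ha, ← hpsum, Polynomial.sum_sq_norm_coeff_eq_circleAverage, Real.circleAverage]
  refine Filter.Tendsto.const_smul ?_ _
  refine intervalIntegral.tendsto_integral_filter_of_dominated_convergence
    (fun _ => (∑' k, ‖a k‖) ^ 2) ?_ ?_ intervalIntegrable_const ?_
  · refine Filter.Eventually.of_forall fun n => Continuous.aestronglyMeasurable ?_
    exact ((p n).continuous.comp (continuous_circleMap 0 1)).norm.pow 2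
  · refine Filter.Eventually.of_forall fun n => Filter.Eventually.of_forall fun θ _ => ?_
    rw [norm_pow, norm_norm, heval]
    refine pow_le_pow_left₀ (norm_nonneg _) ((norm_sum_le _ _).trans ?_) 2
    refine le_trans (le_of_eq (Finset.sum_congr rfl fun k _ => ?_))
      (hsum.sum_le_tsum (Finset.range n) fun k _ => norm_nonneg _)
    rw [ha, norm_mul, norm_pow, norm_circleMap_zero]
  · refine Filter.Eventually.of_forall fun θ _ => ?_
    simp_rw [heval]
    exact ((hF _).tendsto_sum_nat.norm).pow 2

/-- Parseval's identity on a circle, in polar coordinates on `(-π, π)`. -/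
theorem lintegral_enorm_sq_circle {F : ℂ → ℂ} (hFc : Continuous F) {c : ℕ → ℂ}
    (hF : ∀ z, HasSum (fun k => c k * z ^ k) (F z)) {r : ℝ} (hr : 0 ≤ r) :
    ∫⁻ θ in Set.Ioo (-Real.pi) Real.pi, ‖F (r * Real.cos θ + r * Real.sin θ * Complex.I)‖ₑ ^ 2 =
      ENNReal.ofReal (2 * Real.pi) * ∑' k, ‖c k‖ₑ ^ 2 * ENNReal.ofReal (r ^ (2 * k)) := by
  let g : ℝ → ℝ := fun θ => ‖F (circleMap 0 r θ)‖ ^ 2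
  have hg : Continuous g := (hFc.comp (continuous_circleMap 0 r)).norm.pow 2
  have hper : Function.Periodic g (2 * Real.pi) := fun θ => by
    simp only [g, periodic_circleMap 0 r θ]
  have hP := hasSum_sq_norm_coeff_circleAverage hF r
  have hint : ∫ θ in Set.Ioo (-Real.pi) Real.pi, g θ =
      2 * Real.pi * Real.circleAverage (fun z => ‖F z‖ ^ 2) 0 r := by
    rw [← integral_Ioc_eq_integral_Ioo, ← intervalIntegral.integral_of_le
      (by linarith [Real.pi_pos]), Real.circleAverage, smul_eq_mul, ← mul_assoc,
      mul_inv_cancel₀ (by positivity), one_mul]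
    -- Periodicity moves the angular range from `(0, 2π)` to `(-π, π)`, the range of the polar
    -- chart.
    have := hper.intervalIntegral_add_eq (-Real.pi) 0
    rw [zero_add, show -Real.pi + 2 * Real.pi = Real.pi by ring] at this
    exact this
  calc ∫⁻ θ in Set.Ioo (-Real.pi) Real.pi, ‖F (r * Real.cos θ + r * Real.sin θ * Complex.I)‖ₑ ^ 2
      = ∫⁻ θ in Set.Ioo (-Real.pi) Real.pi, ENNReal.ofReal (g θ) := by
        refine lintegral_congr fun θ => ?_
        have : circleMap 0 r θ = r * Real.cos θ + r * Real.sin θ * Complex.I := by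
          rw [circleMap, zero_add, Complex.exp_mul_I, Complex.ofReal_cos, Complex.ofReal_sin]
          ring
        rw [← this, ENNReal.ofReal_pow (norm_nonneg _), ofReal_norm]
    _ = ENNReal.ofReal (∫ θ in Set.Ioo (-Real.pi) Real.pi, g θ) := by
        rw [ofReal_integral_eq_lintegral_ofReal]
        · exact (hg.integrableOn_Icc (μ := volume)).mono_set Set.Ioo_subset_Icc_self
        · exact Filter.Eventually.of_forall fun θ => by positivity
    _ = _ := by
        rw [hint, ENNReal.ofReal_mul (by positivity), ← hP.tsum_eq,
          ENNReal.ofReal_tsum_of_nonneg (fun k => by positivity) hP.summable]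
        congr 2
        ext k
        rw [abs_of_nonneg hr, mul_pow, ENNReal.ofReal_mul (by positivity),
          ENNReal.ofReal_pow (norm_nonneg _), ofReal_norm, ← pow_mul, mul_comm k 2]

/-- The Gamma density `s ↦ sᵏ e⁻ˢ / k!`. -/
noncomputable def gammaWeight (k : ℕ) (s : ℝ) : ℝ := s ^ k * Real.exp (-s) / k.factorial

theorem continuous_gammaWeight (k : ℕ) : Continuous (gammaWeight k) := by
  unfold gammaWeight
  fun_prop

theorem gammaWeight_nonneg (k : ℕ) {s : ℝ} (hs : 0 ≤ s) : 0 ≤ gammaWeight k s := by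
  unfold gammaWeight
  positivity

theorem lintegral_gammaWeight (k : ℕ) :
    ∫⁻ s in Set.Ioi (0 : ℝ), ENNReal.ofReal (gammaWeight k s) = 1 := by
  have h0 : (0 : ℝ) < k + 1 := by positivity
  have hfun : ∀ s : ℝ, gammaWeight k s =
      (Real.exp (-s) * s ^ ((k + 1 : ℝ) - 1)) * (k.factorial : ℝ)⁻¹ := fun s => by
    rw [gammaWeight, add_sub_cancel_right, Real.rpow_natCast]
    ring
  rw [← ofReal_integral_eq_lintegral_ofReal]
  · simp_rw [hfun]
    rw [integral_mul_const, ← Real.Gamma_eq_integral h0, Real.Gamma_nat_eq_factorial,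
      mul_inv_cancel₀ (by positivity), ENNReal.ofReal_one]
  · rw [funext hfun]
    exact (Real.GammaIntegral_convergent h0).mul_const _
  · refine (ae_restrict_iff' measurableSet_Ioi).2 (Filter.Eventually.of_forall fun s hs => ?_)
    exact gammaWeight_nonneg k (le_of_lt hs)

/-- The substitution `s = π r²`. -/
theorem setLIntegral_Ioi_comp_pi_mul_sq (g : ℝ → ℝ≥0∞) :
    ∫⁻ s in Set.Ioi (0 : ℝ), g s =
      ∫⁻ r in Set.Ioi (0 : ℝ), ENNReal.ofReal (2 * Real.pi * r) * g (Real.pi * r ^ 2) := by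
  have himg : (fun r : ℝ => Real.pi * r ^ 2) '' Set.Ioi 0 = Set.Ioi 0 := by
    ext s
    constructor
    · rintro ⟨r, hr, rfl⟩
      have : 0 < r := hr
      exact Set.mem_Ioi.2 (by positivity)
    · intro hs
      have hs' : 0 < s := hs
      refine ⟨Real.sqrt (s / Real.pi), Set.mem_Ioi.2 (Real.sqrt_pos.2 (by positivity)), ?_⟩
      simp only
      rw [Real.sq_sqrt (by positivity)]
      field_simp
  have hinj : Set.InjOn (fun r : ℝ => Real.pi * r ^ 2) (Set.Ioi 0) := by
    intro x hx y hy h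
    have := mul_left_cancel₀ Real.pi_ne_zero h
    exact (pow_left_inj₀ (le_of_lt hx) (le_of_lt hy) two_ne_zero).1 this
  have hder : ∀ r ∈ Set.Ioi (0 : ℝ), HasDerivWithinAt (fun r : ℝ => Real.pi * r ^ 2)
      (2 * Real.pi * r) (Set.Ioi 0) r := fun r _ => by
    refine (((hasDerivAt_pow 2 r).const_mul Real.pi).congr_deriv ?_).hasDerivWithinAt
    push_cast
    ring
  conv_lhs => rw [← himg]
  rw [lintegral_image_eq_lintegral_abs_deriv_mul measurableSet_Ioi hder hinj]
  refine setLIntegral_congr_fun measurableSet_Ioi fun r hr => ?_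
  have : 0 < r := hr
  rw [abs_of_pos (by positivity)]

/-- The radial density in polar coordinates is a Gamma density in `π r²`. -/
theorem ofReal_radial_density (k : ℕ) {r : ℝ} (hr : 0 < r) :
    ENNReal.ofReal r * ENNReal.ofReal (Real.exp (-Real.pi * r ^ 2)) *
      ENNReal.ofReal (2 * Real.pi) * ENNReal.ofReal (r ^ (2 * k)) =
    ENNReal.ofReal (k.factorial / Real.pi ^ k) * ENNReal.ofReal (2 * Real.pi * r) *
      ENNReal.ofReal (gammaWeight k (Real.pi * r ^ 2)) := by
  rw [← ENNReal.ofReal_mul (by positivity), ← ENNReal.ofReal_mul (by positivity),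
    ← ENNReal.ofReal_mul (by positivity), ← ENNReal.ofReal_mul (by positivity),
    ← ENNReal.ofReal_mul (by positivity), gammaWeight]
  congr 1
  rw [mul_pow, ← pow_mul, neg_mul]
  field_simp

/-- The energy of the STFT on a spherically symmetric set as a radial integral. -/
theorem setLIntegral_enorm_stft_sq_eq_radial {f : SignalSpace} {F : ℂ → ℂ}
    (hFd : Differentiable ℂ F)
    (hF : ∀ z : ℝ × ℝ, ‖stft gaussianWindow f z‖ =
      Real.exp (-(Real.pi / 2) * (z.1 ^ 2 + z.2 ^ 2)) * ‖F (z.1 + z.2 * Complex.I)‖)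
    {c : ℕ → ℂ} (hc : ∀ z, HasSum (fun k => c k * z ^ k) (F z))
    {S : Set ℝ} (hS : MeasurableSet S) :
    ∫⁻ z in {z : ℝ × ℝ | z.1 ^ 2 + z.2 ^ 2 ∈ S}, ‖stft gaussianWindow f z‖ₑ ^ 2 =
      ∫⁻ r in Set.Ioi (0 : ℝ), ENNReal.ofReal r *
        (S.indicator 1 (r ^ 2) * ENNReal.ofReal (Real.exp (-Real.pi * r ^ 2))) *
          (ENNReal.ofReal (2 * Real.pi) *
            ∑' k, ‖c k‖ₑ ^ 2 * ENNReal.ofReal (r ^ (2 * k))) := by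
  have hSm : MeasurableSet {z : ℝ × ℝ | z.1 ^ 2 + z.2 ^ 2 ∈ S} := by
    have hm : Measurable fun z : ℝ × ℝ => z.1 ^ 2 + z.2 ^ 2 := by fun_prop
    exact hm hS
  let I : ℝ → ℝ≥0∞ := S.indicator 1
  have hI : Measurable I := measurable_one.indicator hS
  let h : ℝ → ℝ≥0∞ := fun r =>
    ENNReal.ofReal r * (I (r ^ 2) * ENNReal.ofReal (Real.exp (-Real.pi * r ^ 2)))
  have hh : Measurable h := by
    refine ENNReal.measurable_ofReal.mul ((hI.comp (by fun_prop)).mul ?_)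
    exact ENNReal.measurable_ofReal.comp (by fun_prop)
  have hFm : Measurable fun p : ℝ × ℝ =>
      ‖F (p.1 * Real.cos p.2 + p.1 * Real.sin p.2 * Complex.I)‖ₑ ^ 2 := by
    have hF' := hFd.continuous
    exact Continuous.measurable (by fun_prop)
  calc ∫⁻ z in {z : ℝ × ℝ | z.1 ^ 2 + z.2 ^ 2 ∈ S}, ‖stft gaussianWindow f z‖ₑ ^ 2
      = ∫⁻ z : ℝ × ℝ, I (z.1 ^ 2 + z.2 ^ 2) * ‖stft gaussianWindow f z‖ₑ ^ 2 := by
        rw [← lintegral_indicator hSm]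
        refine lintegral_congr fun z => ?_
        by_cases hz : z.1 ^ 2 + z.2 ^ 2 ∈ S <;> simp [I, hz]
    _ = ∫⁻ p in Set.Ioi (0 : ℝ) ×ˢ Set.Ioo (-Real.pi) Real.pi,
          h p.1 * ‖F (p.1 * Real.cos p.2 + p.1 * Real.sin p.2 * Complex.I)‖ₑ ^ 2 := by
        rw [← lintegral_comp_polarCoord_symm, polarCoord_target]
        refine lintegral_congr fun p => ?_
        rw [polarCoord_symm_apply, smul_eq_mul]
        have e1 : (p.1 * Real.cos p.2) ^ 2 + (p.1 * Real.sin p.2) ^ 2 = p.1 ^ 2 := by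
          linear_combination p.1 ^ 2 * Real.cos_sq_add_sin_sq p.2
        have e2 : ‖stft gaussianWindow f (p.1 * Real.cos p.2, p.1 * Real.sin p.2)‖ₑ ^ 2 =
            ENNReal.ofReal (Real.exp (-Real.pi * p.1 ^ 2)) *
              ‖F (p.1 * Real.cos p.2 + p.1 * Real.sin p.2 * Complex.I)‖ₑ ^ 2 := by
          rw [← ofReal_norm, hF, e1, ENNReal.ofReal_mul (by positivity), mul_pow,
            ← ENNReal.ofReal_pow (by positivity), ← Real.exp_nat_mul, ofReal_norm]
          push_cast
          congr 3
          ring_nf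
        rw [e2]
        simp only [e1, h]
        ring
    _ = ∫⁻ r in Set.Ioi (0 : ℝ), h r * (ENNReal.ofReal (2 * Real.pi) *
          ∑' k, ‖c k‖ₑ ^ 2 * ENNReal.ofReal (r ^ (2 * k))) := by
        have hm : Measurable fun p : ℝ × ℝ =>
            h p.1 * ‖F (p.1 * Real.cos p.2 + p.1 * Real.sin p.2 * Complex.I)‖ₑ ^ 2 :=
          (hh.comp measurable_fst).mul hFm
        rw [Measure.volume_eq_prod, setLIntegral_prod _ hm.aemeasurable]
        refine setLIntegral_congr_fun measurableSet_Ioi ?_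
        intro r hr
        dsimp only
        have hm' : Measurable fun θ : ℝ =>
            ‖F (r * Real.cos θ + r * Real.sin θ * Complex.I)‖ₑ ^ 2 := by
          have hF' := hFd.continuous
          exact Continuous.measurable (by fun_prop)
        have hr' : 0 ≤ r := le_of_lt (Set.mem_Ioi.1 hr)
        rw [lintegral_const_mul _ hm', lintegral_enorm_sq_circle hFd.continuous hc hr']

/-- On spherically symmetric sets the Gaussian STFT of any signal has its energy distributed
as a mixture of Gamma densities. -/
theorem exists_lintegral_enorm_stft_sq_eq_tsum (f : SignalSpace) : ∃ d : ℕ → ℝ≥0∞,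
    ∀ S : Set ℝ, MeasurableSet S →
      ∫⁻ z in {z : ℝ × ℝ | z.1 ^ 2 + z.2 ^ 2 ∈ S}, ‖stft gaussianWindow f z‖ₑ ^ 2 =
        ∑' k, d k * ∫⁻ s in Set.Ioi (0 : ℝ),
          S.indicator 1 (s / Real.pi) * ENNReal.ofReal (gammaWeight k s) := by
  obtain ⟨F, hFd, hF⟩ := exists_differentiable_norm_stft f
  let c : ℕ → ℂ := fun k => (k.factorial : ℂ)⁻¹ * iteratedDeriv k F 0
  have hc : ∀ z, HasSum (fun k => c k * z ^ k) (F z) := fun z => by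
    have := Complex.hasSum_taylorSeries_of_entire hFd 0 z
    convert! this using 2 with k
    simp only [sub_zero, smul_eq_mul, c]
    ring
  -- The factor `k!/π^k` is the squared norm of `z^k` for the weight `exp (-π|z|²)` on the plane.
  refine ⟨fun k => ‖c k‖ₑ ^ 2 * ENNReal.ofReal (k.factorial / Real.pi ^ k), fun S hS => ?_⟩
  let I : ℝ → ℝ≥0∞ := S.indicator 1
  have hI : Measurable I := measurable_one.indicator hS
  rw [setLIntegral_enorm_stft_sq_eq_radial hFd hF hc hS]
  calc _ = ∫⁻ r in Set.Ioi (0 : ℝ), ∑' k, ‖c k‖ₑ ^ 2 * ENNReal.ofReal (k.factorial / Real.pi ^ k) *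
          (ENNReal.ofReal (2 * Real.pi * r) *
            (I (Real.pi * r ^ 2 / Real.pi) * ENNReal.ofReal (gammaWeight k (Real.pi * r ^ 2)))) := by
        refine setLIntegral_congr_fun measurableSet_Ioi fun r hr => ?_
        have hr' : 0 < r := hr
        rw [← ENNReal.tsum_mul_left, ← ENNReal.tsum_mul_left]
        congr 1
        ext k
        rw [mul_div_cancel_left₀ _ Real.pi_ne_zero]
        calc _ = ‖c k‖ₑ ^ 2 * I (r ^ 2) * (ENNReal.ofReal r *
              ENNReal.ofReal (Real.exp (-Real.pi * r ^ 2)) *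
              ENNReal.ofReal (2 * Real.pi) * ENNReal.ofReal (r ^ (2 * k))) := by
              ring
          _ = _ := by
              rw [ofReal_radial_density k hr']
              ring
    _ = _ := by
        have hm (k : ℕ) : Measurable fun s : ℝ =>
            I (s / Real.pi) * ENNReal.ofReal (gammaWeight k s) :=
          (hI.comp (by fun_prop)).mul
            (ENNReal.measurable_ofReal.comp (continuous_gammaWeight k).measurable)
        have hm' (k : ℕ) : Measurable fun r : ℝ => ENNReal.ofReal (2 * Real.pi * r) *
            (I (Real.pi * r ^ 2 / Real.pi) * ENNReal.ofReal (gammaWeight k (Real.pi * r ^ 2))) :=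
          (ENNReal.measurable_ofReal.comp (by fun_prop)).mul
            ((hm k).comp (g := fun s : ℝ => I (s / Real.pi) * ENNReal.ofReal (gammaWeight k s))
              (f := fun r : ℝ => Real.pi * r ^ 2) (by fun_prop))
        rw [lintegral_tsum fun k => ((hm' k).const_mul _).aemeasurable]
        congr 1
        ext k
        rw [lintegral_const_mul _ (hm' k), ← setLIntegral_Ioi_comp_pi_mul_sq
          fun s => I (s / Real.pi) * ENNReal.ofReal (gammaWeight k s)]

/-! ### Gamma densities on periodic patterns of cells -/

/-- A bound for the absolute value of the derivative of `gammaWeight k`. -/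
noncomputable def gammaSlope : ℕ → ℝ → ℝ
  | 0, s => gammaWeight 0 s
  | k + 1, s => gammaWeight k s + gammaWeight (k + 1) s

theorem continuous_gammaSlope (k : ℕ) : Continuous (gammaSlope k) := by
  cases k with
  | zero => exact continuous_gammaWeight 0
  | succ k => exact (continuous_gammaWeight k).add (continuous_gammaWeight (k + 1))

theorem gammaSlope_nonneg (k : ℕ) {s : ℝ} (hs : 0 ≤ s) : 0 ≤ gammaSlope k s := by
  cases k with
  | zero => exact gammaWeight_nonneg 0 hs
  | succ k => exact add_nonneg (gammaWeight_nonneg k hs) (gammaWeight_nonneg (k + 1) hs)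

/-- At most two densities of mass 1 occur in the slope. The bound does not depend on `k`, and it is
the source of the 2 in `1 + 2T`. -/
theorem lintegral_gammaSlope_le (k : ℕ) :
    ∫⁻ s in Set.Ioi (0 : ℝ), ENNReal.ofReal (gammaSlope k s) ≤ 2 := by
  cases k with
  | zero =>
    simp only [gammaSlope, lintegral_gammaWeight]
    norm_num
  | succ k =>
    refine le_of_eq ?_
    have h : ∀ s ∈ Set.Ioi (0 : ℝ), ENNReal.ofReal (gammaSlope (k + 1) s) =
        ENNReal.ofReal (gammaWeight k s) + ENNReal.ofReal (gammaWeight (k + 1) s) :=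
      fun s hs => ENNReal.ofReal_add (gammaWeight_nonneg k (le_of_lt hs))
        (gammaWeight_nonneg (k + 1) (le_of_lt hs))
    rw [setLIntegral_congr_fun measurableSet_Ioi h,
      lintegral_add_left (continuous_gammaWeight k).measurable.ennreal_ofReal,
      lintegral_gammaWeight, lintegral_gammaWeight]
    norm_num

/-- The derivative of the density of index `k + 1` is the difference of its predecessor and itself;
for index 0 it is minus the density. -/
theorem exists_hasDerivAt_gammaWeight (k : ℕ) : ∃ w' : ℝ → ℝ, Continuous w' ∧
    (∀ s, HasDerivAt (gammaWeight k) (w' s) s) ∧ ∀ s, 0 ≤ s → |w' s| ≤ gammaSlope k s := by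
  have hexp (s : ℝ) : HasDerivAt (fun s : ℝ => Real.exp (-s)) (-Real.exp (-s)) s := by
    simpa using (hasDerivAt_neg s).exp
  cases k with
  | zero =>
    refine ⟨fun s => -gammaWeight 0 s, (continuous_gammaWeight 0).neg, fun s => ?_, fun s hs => ?_⟩
    · have h : gammaWeight 0 = fun s => Real.exp (-s) := by
        ext s
        simp [gammaWeight]
      rw [h]
      exact hexp s
    · rw [abs_neg, abs_of_nonneg (gammaWeight_nonneg 0 hs)]
      exact le_rfl
  | succ k =>
    refine ⟨fun s => gammaWeight k s - gammaWeight (k + 1) s,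
      (continuous_gammaWeight k).sub (continuous_gammaWeight (k + 1)), fun s => ?_, fun s hs => ?_⟩
    · have h := (((hasDerivAt_pow (k + 1) s).mul (hexp s)).div_const ((k + 1).factorial : ℝ))
      refine h.congr_deriv ?_
      simp only [gammaWeight, Nat.factorial_succ, Nat.add_sub_cancel]
      push_cast
      field_simp
      ring
    · have h1 := gammaWeight_nonneg k hs
      have h2 := gammaWeight_nonneg (k + 1) hs
      simp only [gammaSlope]
      rw [abs_le]
      constructor <;> linarith

/-- A value of a function on an interval is at most its mean plus its total variation. -/
theorem sub_mul_le_integral_add_mul_integral {w w' v : ℝ → ℝ} {a b x : ℝ} (hab : a ≤ b)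
    (hx : x ∈ Set.Icc a b) (hw : ∀ s, HasDerivAt w (w' s) s) (hw' : Continuous w')
    (hv : Continuous v) (hle : ∀ s ∈ Set.Icc a b, |w' s| ≤ v s) :
    (b - a) * w x ≤ ∫ y in a..b, (w y + (b - a) * v y) := by
  have hwc : Continuous w := continuous_iff_continuousAt.2 fun s => (hw s).continuousAt
  -- Two values on the interval differ by at most the integral of `|w'|`; integrating over `y` then
  -- replaces `w y` by its mean.
  have hosc : ∀ y ∈ Set.Icc a b, w x ≤ w y + ∫ s in a..b, v s := by
    intro y hy
    have h1 : ∫ s in y..x, w' s = w x - w y :=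
      intervalIntegral.integral_eq_sub_of_hasDerivAt (fun s _ => hw s)
        (hw'.intervalIntegrable _ _)
    have hsub : Set.uIoc y x ⊆ Set.Ioc a b := by
      intro s hs
      rw [Set.mem_uIoc] at hs
      rcases hs with hs | hs
      · exact ⟨lt_of_le_of_lt hy.1 hs.1, hs.2.trans hx.2⟩
      · exact ⟨lt_of_le_of_lt hx.1 hs.1, hs.2.trans hy.2⟩
    have h2 : ‖∫ s in y..x, w' s‖ ≤ ∫ s in Set.uIoc y x, ‖w' s‖ :=
      intervalIntegral.norm_integral_le_integral_norm_uIoc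
    have h3 : ∫ s in Set.uIoc y x, ‖w' s‖ ≤ ∫ s in Set.Ioc a b, ‖w' s‖ :=
      setIntegral_mono_set (hw'.norm.integrableOn_Ioc)
        (Filter.Eventually.of_forall fun s => norm_nonneg _)
        (Filter.Eventually.of_forall hsub)
    have h4 : ∫ s in Set.Ioc a b, ‖w' s‖ ≤ ∫ s in Set.Ioc a b, v s :=
      setIntegral_mono_on hw'.norm.integrableOn_Ioc hv.integrableOn_Ioc measurableSet_Ioc
        fun s hs => hle s (Set.Ioc_subset_Icc_self hs)
    rw [h1, Real.norm_eq_abs] at h2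
    rw [intervalIntegral.integral_of_le hab]
    linarith [le_abs_self (w x - w y)]
  calc (b - a) * w x = ∫ _ in a..b, w x := by simp
    _ ≤ ∫ y in a..b, (w y + ∫ s in a..b, v s) :=
        intervalIntegral.integral_mono_on hab intervalIntegrable_const
          ((hwc.add continuous_const).intervalIntegrable _ _) hosc
    _ = _ := by
        rw [intervalIntegral.integral_add (hwc.intervalIntegrable _ _) intervalIntegrable_const,
          intervalIntegral.integral_add (hwc.intervalIntegrable _ _)
            ((hv.const_mul _).intervalIntegrable _ _), intervalIntegral.integral_const,
          intervalIntegral.integral_const_mul, smul_eq_mul]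

theorem ofReal_mul_gammaWeight_le (k : ℕ) {a T x : ℝ} (ha : 0 ≤ a) (hT : 0 ≤ T)
    (hx : x ∈ Set.Icc a (a + T)) :
    ENNReal.ofReal T * ENNReal.ofReal (gammaWeight k x) ≤
      ∫⁻ y in Set.Ioc a (a + T),
        (ENNReal.ofReal (gammaWeight k y) + ENNReal.ofReal T * ENNReal.ofReal (gammaSlope k y)) := by
  obtain ⟨w', hw', hw, hle⟩ := exists_hasDerivAt_gammaWeight k
  have h := sub_mul_le_integral_add_mul_integral (by linarith) hx hw hw'
    (continuous_gammaSlope k) fun s hs => hle s (ha.trans hs.1)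
  rw [add_sub_cancel_left, intervalIntegral.integral_of_le (by linarith)] at h
  have hc : Continuous fun y => gammaWeight k y + T * gammaSlope k y :=
    (continuous_gammaWeight k).add ((continuous_gammaSlope k).const_mul T)
  have hpos : ∀ y ∈ Set.Ioc a (a + T), 0 ≤ y := fun y hy => ha.trans hy.1.le
  rw [← ENNReal.ofReal_mul hT]
  refine (ENNReal.ofReal_le_ofReal h).trans (le_of_eq ?_)
  rw [ofReal_integral_eq_lintegral_ofReal hc.integrableOn_Ioc
    ((ae_restrict_iff' measurableSet_Ioc).2 (Filter.Eventually.of_forall fun y hy =>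
      add_nonneg (gammaWeight_nonneg k (hpos y hy))
        (mul_nonneg hT (gammaSlope_nonneg k (hpos y hy)))))]
  refine setLIntegral_congr_fun measurableSet_Ioc fun y hy => ?_
  rw [ENNReal.ofReal_add (gammaWeight_nonneg k (hpos y hy))
    (mul_nonneg hT (gammaSlope_nonneg k (hpos y hy))), ENNReal.ofReal_mul hT]

theorem lintegral_finset_biUnion_le {ι α : Type*} [MeasurableSpace α] {μ : Measure α}
    (D : Finset ι) (s : ι → Set α) (g : α → ℝ≥0∞) :
    ∫⁻ x in ⋃ i ∈ D, s i, g x ∂μ ≤ ∑ i ∈ D, ∫⁻ x in s i, g x ∂μ := by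
  classical
  induction D using Finset.induction_on with
  | empty => simp
  | insert i D hi ih =>
    rw [Finset.set_biUnion_insert, Finset.sum_insert hi]
    exact (lintegral_union_le _ _ _).trans (by gcongr)

/-- A set that consists, in each of the consecutive blocks of `Q` cells of length `l`, of the
cells with index in `D` carries at most the `|D| / Q`-th part of the mass of a Gamma density, up to
the factor `1 + 2 l Q`. -/
theorem setLIntegral_gammaWeight_biUnion_le (k : ℕ) {D : Finset ℕ} {Q : ℕ} {l : ℝ} (hQ : 0 < Q)
    (hl : 0 < l) (hD : ∀ r ∈ D, r < Q) :
    ∫⁻ s in ⋃ q : ℕ, ⋃ r ∈ D,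
        Set.Icc (l * ((q * Q + r : ℕ) : ℝ)) (l * ((q * Q + r : ℕ) : ℝ) + l),
      ENNReal.ofReal (gammaWeight k s) ≤
      ENNReal.ofReal (D.card / Q * (1 + 2 * (l * Q))) := by
  obtain ⟨T, hTdef⟩ : ∃ T : ℝ, T = l * Q := ⟨_, rfl⟩
  rw [← hTdef]
  have hQ' : (0 : ℝ) < Q := by exact_mod_cast hQ
  have hT : 0 < T := by
    rw [hTdef]
    positivity
  let g : ℝ → ℝ≥0∞ := fun y =>
    ENNReal.ofReal (gammaWeight k y) + ENNReal.ofReal T * ENNReal.ofReal (gammaSlope k y)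
  let B : ℕ → ℝ≥0∞ := fun q => ∫⁻ y in Set.Ioc (T * q) (T * q + T), g y
  -- The blocks are disjoint, so their bounds add up to at most the total mass 1 plus `T` times the
  -- slope mass.
  have hB : ∑' q, B q ≤ ENNReal.ofReal (1 + 2 * T) := by
    have hmono : Monotone fun q : ℕ => T * q := fun i j hij => by
      have : (i : ℝ) ≤ j := by exact_mod_cast hij
      exact mul_le_mul_of_nonneg_left this hT.le
    have hdisj := hmono.pairwise_disjoint_on_Ioc_succ
    have hsucc (q : ℕ) : T * ((Order.succ q : ℕ) : ℝ) = T * q + T := by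
      rw [Nat.succ_eq_succ, Nat.cast_succ]
      ring
    simp only [hsucc] at hdisj
    calc ∑' q, B q = ∫⁻ y in ⋃ q : ℕ, Set.Ioc (T * q) (T * q + T), g y :=
          (lintegral_iUnion (fun _ => measurableSet_Ioc) hdisj g).symm
      _ ≤ ∫⁻ y in Set.Ioi 0, g y := by
          refine lintegral_mono_set (Set.iUnion_subset fun q y hy => ?_)
          have h0 : 0 ≤ T * q := by positivity
          exact lt_of_le_of_lt h0 hy.1
      _ = 1 + ENNReal.ofReal T * ∫⁻ y in Set.Ioi 0, ENNReal.ofReal (gammaSlope k y) := by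
          rw [lintegral_add_left (continuous_gammaWeight k).measurable.ennreal_ofReal,
            lintegral_gammaWeight,
            lintegral_const_mul _ (continuous_gammaSlope k).measurable.ennreal_ofReal]
      _ ≤ 1 + ENNReal.ofReal T * 2 := by
          gcongr
          exact lintegral_gammaSlope_le k
      _ = ENNReal.ofReal (1 + 2 * T) := by
          rw [ENNReal.ofReal_add (by norm_num) (by positivity), ENNReal.ofReal_one,
            ENNReal.ofReal_mul (by norm_num), ENNReal.ofReal_ofNat, mul_comm]
  -- A cell has length `l = T / Q`, while the density on it is at most `B q / T`.
  have hcell (q r : ℕ) (hr : r ∈ D) :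
      ∫⁻ s in Set.Icc (l * ((q * Q + r : ℕ) : ℝ)) (l * ((q * Q + r : ℕ) : ℝ) + l),
        ENNReal.ofReal (gammaWeight k s) ≤ ENNReal.ofReal (Q : ℝ)⁻¹ * B q := by
    have hr' : (r : ℝ) + 1 ≤ Q := by exact_mod_cast hD r hr
    have hsub : ∀ s ∈ Set.Icc (l * ((q * Q + r : ℕ) : ℝ)) (l * ((q * Q + r : ℕ) : ℝ) + l),
        ENNReal.ofReal (gammaWeight k s) ≤ ENNReal.ofReal T⁻¹ * B q := by
      intro s hs
      have e : l * ((q * Q + r : ℕ) : ℝ) = T * q + l * r := by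
        rw [hTdef]
        push_cast
        ring
      rw [e] at hs
      have h1 : 0 ≤ l * r := by positivity
      have h2 : l * (r + 1) ≤ T := hTdef ▸ mul_le_mul_of_nonneg_left hr' hl.le
      have hs' : s ∈ Set.Icc (T * q) (T * q + T) := ⟨by linarith [hs.1], by linarith [hs.2]⟩
      have h := ofReal_mul_gammaWeight_le k (by positivity) hT.le hs'
      calc ENNReal.ofReal (gammaWeight k s)
          = ENNReal.ofReal T⁻¹ * (ENNReal.ofReal T * ENNReal.ofReal (gammaWeight k s)) := by
            rw [← mul_assoc, ← ENNReal.ofReal_mul (by positivity), inv_mul_cancel₀ hT.ne',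
              ENNReal.ofReal_one, one_mul]
        _ ≤ ENNReal.ofReal T⁻¹ * B q := by gcongr
    calc _ ≤ ∫⁻ _ in Set.Icc (l * ((q * Q + r : ℕ) : ℝ)) (l * ((q * Q + r : ℕ) : ℝ) + l),
          ENNReal.ofReal T⁻¹ * B q := setLIntegral_mono' measurableSet_Icc hsub
      _ = ENNReal.ofReal (Q : ℝ)⁻¹ * B q := by
          rw [setLIntegral_const, Real.volume_Icc, add_sub_cancel_left, mul_right_comm,
            ← ENNReal.ofReal_mul (by positivity)]
          congr 2
          rw [hTdef]
          field_simp
  calc _ ≤ ∑' q : ℕ, ∫⁻ s in ⋃ r ∈ D,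
        Set.Icc (l * ((q * Q + r : ℕ) : ℝ)) (l * ((q * Q + r : ℕ) : ℝ) + l),
          ENNReal.ofReal (gammaWeight k s) := lintegral_iUnion_le _ _
    _ ≤ ∑' q : ℕ, D.card * (ENNReal.ofReal (Q : ℝ)⁻¹ * B q) := by
        refine ENNReal.tsum_le_tsum fun q => ?_
        refine (lintegral_finset_biUnion_le D _ _).trans ?_
        refine (Finset.sum_le_sum fun r hr => hcell q r hr).trans (le_of_eq ?_)
        rw [Finset.sum_const, nsmul_eq_mul]
    _ = D.card * ENNReal.ofReal (Q : ℝ)⁻¹ * ∑' q, B q := by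
        rw [ENNReal.tsum_mul_left, ENNReal.tsum_mul_left, mul_assoc]
    _ ≤ D.card * ENNReal.ofReal (Q : ℝ)⁻¹ * ENNReal.ofReal (1 + 2 * T) := by gcongr
    _ = _ := by
        rw [← ENNReal.ofReal_natCast, ← ENNReal.ofReal_mul (by positivity),
          ← ENNReal.ofReal_mul (by positivity), div_eq_mul_inv]

/-! ### Low digits of the Cantor set -/

/-- The sums `∑_{j < p} a_j ∏_{l < j} b_l` with digits `a_j ∈ A_j`, as a finite set. -/
def digitSums (b : ℕ → ℕ) (A : ℕ → Finset ℕ) : ℕ → Finset ℕ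
  | 0 => {0}
  | p + 1 => Finset.image₂ (fun x a => x + a * ∏ l ∈ Finset.range p, b l) (digitSums b A p) (A p)

theorem card_digitSums_le (b : ℕ → ℕ) (A : ℕ → Finset ℕ) (p : ℕ) :
    (digitSums b A p).card ≤ ∏ j ∈ Finset.range p, (A j).card := by
  induction p with
  | zero => simp [digitSums]
  | succ p ih =>
    rw [Finset.prod_range_succ, digitSums]
    exact (Finset.card_image₂_le _ _ _).trans (Nat.mul_le_mul_right _ ih)

theorem lt_prod_of_mem_digitSums {b : ℕ → ℕ} {A : ℕ → Finset ℕ}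
    (hA : ∀ j, A j ⊆ Finset.range (b j)) (p : ℕ) :
    ∀ r ∈ digitSums b A p, r < ∏ j ∈ Finset.range p, b j := by
  induction p with
  | zero => simp [digitSums]
  | succ p ih =>
    intro r hr
    obtain ⟨x, hx, a, ha, rfl⟩ := Finset.mem_image₂.1 hr
    have h1 := ih x hx
    have h2 : a + 1 ≤ b p := Finset.mem_range.1 (hA p ha)
    rw [Finset.prod_range_succ]
    calc x + a * ∏ l ∈ Finset.range p, b l
        < ∏ l ∈ Finset.range p, b l + a * ∏ l ∈ Finset.range p, b l := by omega
      _ = (∏ l ∈ Finset.range p, b l) * (a + 1) := by ring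
      _ ≤ _ := Nat.mul_le_mul_left _ h2

theorem sum_mem_digitSums {b : ℕ → ℕ} {A : ℕ → Finset ℕ} {a : ℕ → ℕ} (p : ℕ)
    (ha : ∀ j < p, a j ∈ A j) :
    ∑ j ∈ Finset.range p, a j * ∏ l ∈ Finset.range j, b l ∈ digitSums b A p := by
  induction p with
  | zero => simp [digitSums]
  | succ p ih =>
    rw [Finset.sum_range_succ, digitSums]
    exact Finset.mem_image₂_of_mem (ih fun j hj => ha j (by omega)) (ha p (by omega))

/-- The terms with `j ≥ p` are divisible by the product of the first `p` bases, so only the low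
digits determine the position inside a block. Nothing is retained about the block number `q`. -/
theorem exists_digitSums_of_mem_discreteCantorSet {b : ℕ → ℕ} {A : ℕ → Finset ℕ} {n p m : ℕ}
    (hp : p ≤ n) (hm : m ∈ discreteCantorSet b A n) :
    ∃ q, ∃ r ∈ digitSums b A p, m = q * ∏ j ∈ Finset.range p, b j + r := by
  obtain ⟨a, ha, rfl⟩ := hm
  have hdvd : ∏ j ∈ Finset.range p, b j ∣
      ∑ j ∈ Finset.Ico p n, a j * ∏ l ∈ Finset.range j, b l := by
    refine Finset.dvd_sum fun j hj => Dvd.dvd.mul_left ?_ _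
    exact Finset.prod_dvd_prod_of_subset _ _ _
      (Finset.range_subset_range.2 (Finset.mem_Ico.1 hj).1)
  obtain ⟨q, hq⟩ := hdvd
  refine ⟨q, _, sum_mem_digitSums p fun j hj => ha j (hj.trans_le hp), ?_⟩
  rw [← Finset.sum_range_add_sum_Ico _ hp, hq]
  ring

/-- The mass that a Gamma density gives to an indexed Cantor set, bounded by means of the
`p` finest generations. -/
theorem lintegral_indicator_cantorSet_gammaWeight_le {b : ℕ → ℕ} {A : ℕ → Finset ℕ}
    (hb : ∀ j, 0 < b j) (hA : ∀ j, A j ⊆ Finset.range (b j)) {R : ℝ} (hR : 0 < R) {n p : ℕ}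
    (hp : p ≤ n) (k : ℕ) :
    ∫⁻ s in Set.Ioi (0 : ℝ), (cantorSet (R ^ 2) b A n).indicator 1 (s / Real.pi) *
        ENNReal.ofReal (gammaWeight k s) ≤
      ENNReal.ofReal ((∏ j ∈ Finset.range p, ((A j).card : ℝ) / b j) *
        (1 + 2 * (Real.pi * blockLength (R ^ 2) b n * ∏ j ∈ Finset.range p, (b j : ℝ)))) := by
  set Q : ℕ := ∏ j ∈ Finset.range p, b j with hQdef
  have hQ : 0 < Q := Finset.prod_pos fun j _ => hb j
  set l : ℝ := Real.pi * blockLength (R ^ 2) b n with hldef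
  have hl : 0 < l := by
    have : 0 < ∏ j ∈ Finset.range n, (b j : ℝ) :=
      Finset.prod_pos fun j _ => by exact_mod_cast hb j
    have := Real.pi_pos
    rw [hldef, blockLength]
    positivity
  -- This larger set admits every block `q`, including those excluded by the higher digits, and is
  -- already dilated by `π`.
  let E : Set ℝ := ⋃ q : ℕ, ⋃ r ∈ digitSums b A p,
    Set.Icc (l * ((q * Q + r : ℕ) : ℝ)) (l * ((q * Q + r : ℕ) : ℝ) + l)
  have hE : MeasurableSet E := MeasurableSet.iUnion fun q =>
    Finset.measurableSet_biUnion _ fun r _ => measurableSet_Icc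
  have hsub (s : ℝ) (hs : s / Real.pi ∈ cantorSet (R ^ 2) b A n) : s ∈ E := by
    obtain ⟨m, hm, hsm⟩ := Set.mem_iUnion₂.1 hs
    obtain ⟨q, r, hr, rfl⟩ := exists_digitSums_of_mem_discreteCantorSet hp hm
    refine Set.mem_iUnion.2 ⟨q, Set.mem_iUnion₂.2 ⟨r, hr, ?_⟩⟩
    have h1 := mul_le_mul_of_nonneg_left hsm.1 Real.pi_pos.le
    have h2 := mul_le_mul_of_nonneg_left hsm.2 Real.pi_pos.le
    rw [mul_div_cancel₀ _ Real.pi_ne_zero] at h1 h2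
    rw [← mul_assoc] at h1
    rw [mul_add, ← mul_assoc] at h2
    exact ⟨h1, h2⟩
  calc _ ≤ ∫⁻ s, E.indicator (fun s => ENNReal.ofReal (gammaWeight k s)) s := by
        refine (setLIntegral_le_lintegral _ _).trans (lintegral_mono fun s => ?_)
        by_cases hs : s / Real.pi ∈ cantorSet (R ^ 2) b A n
        · simp [hs, hsub s hs]
        · simp [hs]
    _ = ∫⁻ s in E, ENNReal.ofReal (gammaWeight k s) := lintegral_indicator hE _
    _ ≤ ENNReal.ofReal ((digitSums b A p).card / Q * (1 + 2 * (l * Q))) :=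
        setLIntegral_gammaWeight_biUnion_le k hQ hl (lt_prod_of_mem_digitSums hA p)
    _ ≤ _ := by
        refine ENNReal.ofReal_le_ofReal ?_
        rw [Finset.prod_div_distrib, hQdef, Nat.cast_prod]
        have hc : ((digitSums b A p).card : ℝ) ≤ ∏ j ∈ Finset.range p, ((A j).card : ℝ) := by
          exact_mod_cast card_digitSums_le b A p
        have h0 : (0 : ℝ) ≤ ∏ j ∈ Finset.range p, (b j : ℝ) :=
          Finset.prod_nonneg fun j _ => Nat.cast_nonneg _
        gcongr

/-! ### From Gamma masses to the operator norm -/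

/-- The fraction of the energy of the STFT in a spherically symmetric set is at most the largest
mass that a Gamma density gives to the set. -/
theorem lintegral_enorm_stft_sq_le_of_gammaWeight {S : Set ℝ} (hS : MeasurableSet S) {κ : ℝ}
    (hκ : 0 ≤ κ)
    (h : ∀ k, ∫⁻ s in Set.Ioi (0 : ℝ), S.indicator 1 (s / Real.pi) *
      ENNReal.ofReal (gammaWeight k s) ≤ ENNReal.ofReal κ) (f : SignalSpace) :
    ∫⁻ z in {z : ℝ × ℝ | z.1 ^ 2 + z.2 ^ 2 ∈ S}, ‖stft gaussianWindow f z‖ₑ ^ 2 ≤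
      ENNReal.ofReal (κ * ‖f‖ ^ 2) := by
  obtain ⟨d, hd⟩ := exists_lintegral_enorm_stft_sq_eq_tsum f
  have hd1 : ∑' k, d k = ENNReal.ofReal (‖f‖ ^ 2) := by
    -- On the whole plane every Gamma mass is 1, so Moyal's identity evaluates the sum of the `d k`.
    have h1 := hd Set.univ MeasurableSet.univ
    simp only [Set.mem_univ, Set.ofPred_true, Measure.restrict_univ, Set.indicator_univ,
      Pi.one_apply, one_mul, lintegral_gammaWeight, mul_one, lintegral_enorm_stft_sq] at h1
    exact h1.symm
  rw [hd S hS, ENNReal.ofReal_mul hκ, ← hd1, ← ENNReal.tsum_mul_left]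
  refine ENNReal.tsum_le_tsum fun k => ?_
  rw [mul_comm]
  gcongr
  exact h k

/-- A localization operator on a spherically symmetric Cantor set has norm at most the largest mass
that a Gamma density gives to the set. -/
theorem norm_cantorLocalizationOperator_le {R : ℝ} {b : ℕ → ℕ} {A : ℕ → Finset ℕ} {n : ℕ} {κ : ℝ}
    (hκ : 0 ≤ κ)
    (h : ∀ k, ∫⁻ s in Set.Ioi (0 : ℝ), (cantorSet (R ^ 2) b A n).indicator 1 (s / Real.pi) *
      ENNReal.ofReal (gammaWeight k s) ≤ ENNReal.ofReal κ) :
    ‖cantorLocalizationOperator R b A n‖ ≤ κ := by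
  have hS : MeasurableSet (cantorSet (R ^ 2) b A n) :=
    MeasurableSet.biUnion (Set.to_countable _) fun _ _ => measurableSet_Icc
  set E := sphericalCantorSet R b A n with hE
  have hEm : MeasurableSet E := measurableSet_sphericalCantorSet R b A n
  have hbound (f : SignalSpace) :
      MemLp (stft gaussianWindow f) 2 (volume.restrict E) ∧
      ∫ z in E, ‖stft gaussianWindow f z‖ ^ 2 ≤ κ * ‖f‖ ^ 2 := by
    have hl : ∫⁻ z in E, ‖stft gaussianWindow f z‖ₑ ^ 2 ≤ ENNReal.ofReal (κ * ‖f‖ ^ 2) :=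
      lintegral_enorm_stft_sq_le_of_gammaWeight hS hκ h f
    have he : ∀ z, ENNReal.ofReal (‖stft gaussianWindow f z‖ ^ 2) =
        ‖stft gaussianWindow f z‖ₑ ^ 2 := fun z => by
      rw [ENNReal.ofReal_pow (norm_nonneg _), ofReal_norm]
    have hm := (stronglyMeasurable_stft f).aestronglyMeasurable (μ := volume.restrict E)
    have hm2 : AEStronglyMeasurable (fun z => ‖stft gaussianWindow f z‖ ^ 2)
        (volume.restrict E) := hm.norm.pow 2
    constructor
    · rw [memLp_two_iff_integrable_sq_norm hm]
      refine ⟨hm2, ?_⟩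
      rw [hasFiniteIntegral_iff_ofReal (Filter.Eventually.of_forall fun z => by positivity)]
      simp_rw [he]
      exact hl.trans_lt ENNReal.ofReal_lt_top
    · rw [integral_eq_lintegral_of_nonneg_ae (Filter.Eventually.of_forall fun z => by positivity)
        hm2]
      simp_rw [he]
      exact ENNReal.toReal_le_of_le_ofReal (by positivity) hl
  have hform (f g : SignalSpace) :
      ‖inner ℂ g (cantorLocalizationOperator R b A n f)‖ ≤ κ * (‖f‖ * ‖g‖) := by
    rw [cantorLocalizationOperator, inner_localizationOperator]
    have e : ∫ z : ℝ × ℝ, (((E.indicator (fun _ => (1 : ℝ)) z : ℝ) : ℂ) *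
        stft gaussianWindow f z) * starRingEnd ℂ (stft gaussianWindow g z) =
        ∫ z in E, stft gaussianWindow f z * starRingEnd ℂ (stft gaussianWindow g z) := by
      rw [← integral_indicator hEm]
      refine integral_congr_ae (Filter.Eventually.of_forall fun z => ?_)
      by_cases hz : z ∈ E <;> simp [hz]
    rw [e]
    obtain ⟨hf1, hf2⟩ := hbound f
    obtain ⟨hg1, hg2⟩ := hbound g
    calc ‖∫ z in E, stft gaussianWindow f z * starRingEnd ℂ (stft gaussianWindow g z)‖
        ≤ ∫ z in E, ‖stft gaussianWindow f z‖ * ‖stft gaussianWindow g z‖ := by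
          refine (norm_integral_le_integral_norm _).trans (le_of_eq ?_)
          simp only [norm_mul, RCLike.norm_conj]
      _ ≤ (∫ z in E, ‖stft gaussianWindow f z‖ ^ (2 : ℝ)) ^ (1 / (2 : ℝ)) *
          (∫ z in E, ‖stft gaussianWindow g z‖ ^ (2 : ℝ)) ^ (1 / (2 : ℝ)) := by
          refine integral_mul_norm_le_Lp_mul_Lq (by constructor <;> norm_num) ?_ ?_
          · simpa using hf1
          · simpa using hg1
      _ ≤ (κ * ‖f‖ ^ 2) ^ (1 / (2 : ℝ)) * (κ * ‖g‖ ^ 2) ^ (1 / (2 : ℝ)) := by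
          simp_rw [Real.rpow_two]
          gcongr
      _ = κ * (‖f‖ * ‖g‖) := by
          rw [← Real.mul_rpow (by positivity) (by positivity), ← Real.sqrt_eq_rpow,
            show κ * ‖f‖ ^ 2 * (κ * ‖g‖ ^ 2) = (κ * (‖f‖ * ‖g‖)) ^ 2 by ring,
            Real.sqrt_sq (by positivity)]
  refine ContinuousLinearMap.opNorm_le_bound _ hκ fun f => ?_
  -- Testing the form bound with `g = P f` gives `‖u‖² ≤ κ ‖f‖ ‖u‖`.
  set u := cantorLocalizationOperator R b A n f with hu
  have h1 := hform f u
  rw [inner_self_eq_norm_sq_to_K, norm_pow, RCLike.norm_ofReal, abs_norm] at h1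
  rcases (norm_nonneg u).eq_or_lt with h0 | h0
  · rw [← h0]
    positivity
  · refine le_of_mul_le_mul_right ?_ h0
    linarith

/-! ### Choice of the scale and conclusion -/

/-- Choice of the number of generations that are resolved at unit scale. -/
theorem prod_range_floor_le_sqrt {δ M : ℝ} (hδ : 0 < δ) (hM : 1 < M) {b : ℕ → ℕ}
    (hb : ∀ j, (b j : ℝ) ∈ Set.Icc M (M ^ (1 + δ))) (n : ℕ) :
    ∏ j ∈ Finset.range ⌊(n : ℝ) / (2 * (1 + δ))⌋₊, (b j : ℝ) ≤
      Real.sqrt (∏ j ∈ Finset.range n, (b j : ℝ)) := by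
  set p := ⌊(n : ℝ) / (2 * (1 + δ))⌋₊ with hp
  have hM0 : 0 < M := by linarith
  have h1 : ∏ j ∈ Finset.range p, (b j : ℝ) ≤ M ^ ((1 + δ) * p) := by
    calc ∏ j ∈ Finset.range p, (b j : ℝ) ≤ ∏ j ∈ Finset.range p, M ^ (1 + δ) :=
          Finset.prod_le_prod (fun j _ => Nat.cast_nonneg _) fun j _ => (hb j).2
      _ = M ^ ((1 + δ) * p) := by
          rw [Finset.prod_const, Finset.card_range, Real.rpow_mul hM0.le, Real.rpow_natCast]
  have h2 : M ^ (n : ℝ) ≤ ∏ j ∈ Finset.range n, (b j : ℝ) := by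
    calc M ^ (n : ℝ) = ∏ j ∈ Finset.range n, M := by simp
      _ ≤ _ := Finset.prod_le_prod (fun j _ => hM0.le) fun j _ => (hb j).1
  have hpn : (p : ℝ) ≤ n / (2 * (1 + δ)) := Nat.floor_le (by positivity)
  refine Real.le_sqrt_of_sq_le ((pow_le_pow_left₀ ?_ h1 2).trans (le_trans ?_ h2))
  · exact Finset.prod_nonneg fun j _ => Nat.cast_nonneg _
  · rw [← Real.rpow_natCast, ← Real.rpow_mul hM0.le]
    refine Real.rpow_le_rpow_of_exponent_le hM.le ?_
    rw [le_div_iff₀ (by positivity)] at hpn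
    push_cast
    linarith

end CantorLocalization

theorem mainTheorem5 (ε δ γ : ℝ) (hε : ε < 1) (hδ : 0 < δ) (hγ : 0 < γ) :
    ∃ α β : ℝ, 0 < α ∧ 0 < β ∧
      ∀ (M : ℝ) (b : ℕ → ℕ) (A : ℕ → Finset ℕ) (R : ℕ → ℝ),
        1 < M →
        (∀ j, (b j : ℝ) ∈ Set.Icc M (M ^ (1 + δ))) →
        (∀ j, (A j).Nonempty ∧ A j ⊆ Finset.range (b j)) →
        (∀ j, ((A j).card : ℝ) / (b j : ℝ) ≤ ε) →
        (∀ n, 0 < R n) →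
        (∀ n, Real.pi * R n ^ 2 ≤ γ * Real.sqrt (∏ l ∈ Finset.range n, (b l : ℝ))) →
        ∀ n : ℕ, ‖CantorLocalization.cantorLocalizationOperator (R n) b A n‖
          ≤ α * Real.exp (-β * n) := by
  -- The given `ε` may be zero or negative; `η` is kept positive so that its logarithm and inverse
  -- make sense.
  obtain ⟨η, hη0, hη1, hεη⟩ : ∃ η : ℝ, 0 < η ∧ η < 1 ∧ ε ≤ η :=
    ⟨max ε (1 / 2), by positivity, max_lt hε (by norm_num), le_max_left _ _⟩
  have hlog : Real.log η < 0 := Real.log_neg hη0 hη1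
  -- The factor `1 + 2γ` comes from blocks of length at most `γ`, `η⁻¹` pays for rounding `p` down,
  -- and the rate is that of `η^p` with `p` close to `n / (2(1+δ))`.
  refine ⟨(1 + 2 * γ) * η⁻¹, -Real.log η / (2 * (1 + δ)), by positivity,
    div_pos (by linarith) (by positivity), ?_⟩
  intro M b A R hM hb hA hAb hR hRγ n
  have hb0 : ∀ j, 0 < b j := fun j => by
    have : (0 : ℝ) < b j := by linarith [(hb j).1]
    exact_mod_cast this
  set p := ⌊(n : ℝ) / (2 * (1 + δ))⌋₊ with hp
  set N : ℝ := ∏ j ∈ Finset.range n, (b j : ℝ) with hN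
  have hN0 : 0 < N := Finset.prod_pos fun j _ => by exact_mod_cast hb0 j
  have hpn : p ≤ n := by
    refine Nat.floor_le_of_le (div_le_self (Nat.cast_nonneg n) ?_)
    linarith
  -- The block length is `πR²Q/N`, and each of `πR²/γ` and `Q` is at most `√N`.
  have hT : Real.pi * CantorLocalization.blockLength (R n ^ 2) b n *
      ∏ j ∈ Finset.range p, (b j : ℝ) ≤ γ := by
    have hQ := CantorLocalization.prod_range_floor_le_sqrt hδ hM hb n
    calc _ = Real.pi * R n ^ 2 * (∏ j ∈ Finset.range p, (b j : ℝ)) * N⁻¹ := by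
          rw [CantorLocalization.blockLength]
          ring
      _ ≤ γ * Real.sqrt N * Real.sqrt N * N⁻¹ := by
          refine mul_le_mul_of_nonneg_right (mul_le_mul (hRγ n) hQ ?_ ?_) (inv_nonneg.2 hN0.le)
          · exact Finset.prod_nonneg fun j _ => Nat.cast_nonneg _
          · positivity
      _ = γ := by
          rw [mul_assoc γ, Real.mul_self_sqrt hN0.le, mul_assoc, mul_inv_cancel₀ hN0.ne', mul_one]
  have hprod : ∏ j ∈ Finset.range p, ((A j).card : ℝ) / b j ≤ η ^ p := by
    calc _ ≤ ∏ _j ∈ Finset.range p, η :=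
          Finset.prod_le_prod (fun j _ => by positivity) fun j _ => (hAb j).trans hεη
      _ = η ^ p := by simp
  -- Since `log η < 0`, the inequality `n / (2(1+δ)) < p + 1` bounds `η^(p+1)` from above.
  have hexp : η ^ p ≤ η⁻¹ * Real.exp (-(-Real.log η / (2 * (1 + δ))) * n) := by
    have hfl : (n : ℝ) / (2 * (1 + δ)) < p + 1 := Nat.lt_floor_add_one _
    rw [← Real.exp_log hη0, ← Real.exp_neg, ← Real.exp_nat_mul, ← Real.exp_add, Real.log_exp]
    refine Real.exp_le_exp.2 ?_
    have := mul_le_mul_of_nonpos_left hfl.le hlog.le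
    calc (p : ℝ) * Real.log η = Real.log η * (p + 1) - Real.log η := by ring
      _ ≤ Real.log η * (n / (2 * (1 + δ))) - Real.log η := by linarith
      _ = _ := by ring
  have hT0 : 0 ≤ Real.pi * CantorLocalization.blockLength (R n ^ 2) b n *
      ∏ j ∈ Finset.range p, (b j : ℝ) := by
    have := Real.pi_pos
    rw [CantorLocalization.blockLength]
    positivity
  refine CantorLocalization.norm_cantorLocalizationOperator_le (by positivity) fun k =>
    (CantorLocalization.lintegral_indicator_cantorSet_gammaWeight_le hb0 (fun j => (hA j).2)
      (hR n) hpn k).trans (ENNReal.ofReal_le_ofReal ?_)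
  calc _ ≤ (η⁻¹ * Real.exp (-(-Real.log η / (2 * (1 + δ))) * n)) * (1 + 2 * γ) := by
        gcongr
        exact hprod.trans hexp
    _ = _ := by ring
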